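/- Let $p$ be a prime and let $\mathcal F$ be a non-archimedean local field of characteristic $p$, with absolute value $|\cdot|$, valuation ring $\mathcal O$ and residue field of cardinality $q$. Fix a prime element $\pi$ of $\mathcal O$ and let $\mathbb F_q\subset\mathcal O$ be the copy of the residue field in $\mathcal F$ (the roots of $X^q-X$). Every $x\in\mathcal F$ has a unique expansion $x=\sum_{n\ge v}c_n\pi^n$ with $v\in\mathbb Z$ and $c_n\in\mathbb F_q$; its integral part is $[x]:=\sum_{n\ge 0}c_n\pi^n\in\mathcal O$. Let $\mu$ be the Haar measure of the compact additive group $\mathcal O$ with $\mu(\mathcal O)=1$. For $k\ge 1$ let $$\widetilde{\mathcal S}_k:=\Bigl\{\sum_{i\ge 0}c_i\pi^i:\ c_i\in\mathbb F_q,\ c_i=0\text{ if }p^k\nmid i\Bigr\},$$ a closed additive subgroup of $\mathcal O$, let $\mu_k$ be its Haar measure with $\mu_k(\widetilde{\mathcal S}_k)=1$, and define the Borel measure $\mu^*$ on $\mathcal O$ by $$\mu^*(D):=\Bigl(1-\frac1p\Bigr)\Bigl(\mu(D)+\sum_{k=1}^\infty p^{-k}\mu_k\bigl(D\cap\widetilde{\mathcal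 S}_k\bigr)\Bigr).$$ A sequence $(x_n)_{n\ge1}$ in a compact Hausdorff space $X$ is called $m$-uniformly distributed ($m$-u.d.), for a Borel probability measure $m$ on $X$, if $\frac1N\sum_{n=1}^N\delta_{x_n}\to m$ in the weak-$*$ topology as $N\to\infty$. Then: (a) For every $x\in\mathcal F$ with $|x|>1$, the sequence $([x^n])_{n\ge1}$ is not $\mu$-u.d. in $\mathcal O$. (b) For every integer $k\ge1$ and Haar-almost every $x\in\mathcal F$ with $|x|>1$, the subsequence of $([x^n])_{n\ge1}$ along those $n$ with $p^k\mid n$ and $p^{k+1}\nmid n$ lies in $\widetilde{\mathcal S}_k$ and is $\mu_k$-u.d. in $\widetilde{\mathcal S}_k$. (c) For Haar-almost every $x\in\mathcal F$ with $|x|>1$, the sequence $([x^n])_{n\ge1}$ is $\mu^*$-u.d. in $\mathcal O$. -/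

import Mathlib

open Filter Topology MeasureTheory ValuativeRel
open scoped ENNReal

namespace LocalFieldPowers

section Uniform

/-- The sequence `s` in the compact space `X` is `μ`-uniformly distributed: the measures
`(1/N) ∑_{n < N} δ_{s n}` converge to `μ` in the weak-* topology. -/
def IsUD {X : Type*} [TopologicalSpace X] [MeasurableSpace X] (μ : Measure X) (s : ℕ → X) : Prop :=
  ∀ f : C(X, ℝ),
    Tendsto (fun N : ℕ => (N : ℝ)⁻¹ * ∑ n ∈ Finset.range N, f (s n)) atTop (𝓝 (∫ y, f y ∂μ))

/-- The Haar measure of a compact additive group, normalised to total mass `1`. -/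
noncomputable def haarProb (G : Type*) [AddGroup G] [TopologicalSpace G] [IsTopologicalAddGroup G]
    [CompactSpace G] [MeasurableSpace G] [BorelSpace G] : Measure G :=
  Measure.addHaarMeasure (⊤ : TopologicalSpace.PositiveCompacts G)

end Uniform

section Field

variable (F : Type*) [Field F] [ValuativeRel F] [TopologicalSpace F] [IsNonarchimedeanLocalField F]

theorem t2Space : T2Space F := by
  let := IsTopologicalAddGroup.rightUniformSpace F
  have := isUniformAddGroup_of_addCommGroup (G := F)
  have : T0Space F := ValuedRing.separated
  infer_instance

theorem charP_residueField (p : ℕ) [Fact p.Prime] [CharP F p] : CharP 𝓀[F] p := by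
  have h : ((p : ℕ) : 𝓀[F]) = 0 := by
    rw [← map_natCast (IsLocalRing.residue 𝒪[F]) p, CharP.cast_eq_zero 𝒪[F] p, map_zero]
  obtain ⟨r, hr⟩ := CharP.exists 𝓀[F]
  have h1 : r ∣ p := (CharP.cast_eq_zero_iff 𝓀[F] r p).1 h
  rcases (Nat.dvd_prime Fact.out).1 h1 with rfl | rfl
  · exact absurd (ringChar.eq 𝓀[F] 1) (fun h => CharP.ringChar_ne_one (R := 𝓀[F]) h)
  · exact hr

theorem exists_card_eq (p : ℕ) [Fact p.Prime] [CharP F p] : ∃ n : ℕ, Nat.card 𝓀[F] = p ^ n := by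
  have := charP_residueField F p
  have := Fintype.ofFinite 𝓀[F]
  obtain ⟨n, -, hn⟩ := FiniteField.card 𝓀[F] p
  exact ⟨n, by rw [Nat.card_eq_fintype_card, hn]⟩

/-- The copy of the residue field `𝔽_q` inside a local field `F` of characteristic `p`: the roots
of `X ^ q - X`, where `q` is the cardinality of the residue field. It is the set of digits. -/
def constants (p : ℕ) [Fact p.Prime] [CharP F p] : Subring 𝒪[F] where
  carrier := {c | c ^ Nat.card 𝓀[F] = c}
  mul_mem' := by
    intro a b ha hb
    simp only [Set.mem_ofPred_eq] at *
    rw [mul_pow, ha, hb]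
  one_mem' := by simp
  zero_mem' := by
    simp only [Set.mem_ofPred_eq]
    exact zero_pow Nat.card_pos.ne'
  add_mem' := by
    intro a b ha hb
    obtain ⟨n, hn⟩ := exists_card_eq F p
    simp only [Set.mem_ofPred_eq, hn] at *
    rw [add_pow_char_pow, ha, hb]
  neg_mem' := by
    intro a ha
    obtain ⟨n, hn⟩ := exists_card_eq F p
    simp only [Set.mem_ofPred_eq, hn] at *
    have h : (a + -a) ^ p ^ n = a ^ p ^ n + (-a) ^ p ^ n := add_pow_char_pow a (-a) p n
    rw [add_neg_cancel, zero_pow (pow_ne_zero n (Fact.out : p.Prime).ne_zero), ha] at h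
    exact eq_neg_of_add_eq_zero_right h.symm

variable {F}
variable (p : ℕ) [Fact p.Prime] [CharP F p] (π : 𝒪[F])

/-- `x = ∑_{n ≥ v} c_n π ^ n` for some integer `v`, with all digits `c_n` in `𝔽_q`. -/
def IsExpansion (x : F) (c : ℤ → 𝒪[F]) : Prop :=
  (∀ n, c n ∈ constants F p) ∧ (∃ v : ℤ, ∀ n < v, c n = 0) ∧
    HasSum (fun n : ℤ => (c n : F) * (π : F) ^ n) x

open Classical in
/-- The sequence of digits of `x` with respect to the prime element `π`
(if `π` is prime, then the expansion exists and is unique). -/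
noncomputable def digits (x : F) : ℤ → 𝒪[F] :=
  if h : ∃ c, IsExpansion p π x c then h.choose else 0

/-- The integral part `[x] = ∑_{n ≥ 0} c_n π ^ n` of `x = ∑_n c_n π ^ n`. -/
noncomputable def intPart (x : F) : 𝒪[F] :=
  ∑' n : ℕ, digits p π x n * π ^ n

/-- The additive subgroup of `𝒪` that consists of the series `∑_{i ≥ 0} c_i π ^ i` with digits in
`𝔽_q` such that `c_i = 0` unless `p ^ k` divides `i`. -/
def supp (k : ℕ) : AddSubgroup 𝒪[F] where
  carrier := {x | ∃ c : ℕ → 𝒪[F], (∀ i, c i ∈ constants F p) ∧ (∀ i, ¬ p ^ k ∣ i → c i = 0) ∧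
    HasSum (fun i => c i * π ^ i) x}
  zero_mem' := ⟨0, fun _ => zero_mem _, fun _ _ => rfl, by simp⟩
  add_mem' := by
    rintro x y ⟨c, hc, hc', hx⟩ ⟨d, hd, hd', hy⟩
    refine ⟨c + d, fun i => add_mem (hc i) (hd i), fun i hi => by simp [hc' i hi, hd' i hi], ?_⟩
    simpa [add_mul] using hx.add hy
  neg_mem' := by
    rintro x ⟨c, hc, hc', hx⟩
    refine ⟨-c, fun i => neg_mem (hc i), fun i hi => by simp [hc' i hi], ?_⟩
    simpa [neg_mul] using hx.neg

variable {π}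

theorem hasSum_digits_iff (hπ : Irreducible π) (c : ℕ → 𝒪[F]) (x : 𝒪[F]) :
    HasSum (fun i => c i * π ^ i) x ↔
      ∀ N, x - ∑ i ∈ Finset.range N, c i * π ^ i ∈ Ideal.span {π ^ N} := by
  have := t2Space F
  have hcl : ∀ N, IsClosed ((Ideal.span {π ^ N} : Ideal 𝒪[F]) : Set 𝒪[F]) :=
    fun N => IsNoetherianRing.isClosed_ideal _
  have hmem : ∀ (N : ℕ) (s : Finset ℕ), Finset.range N ⊆ s →
      ∑ i ∈ s, c i * π ^ i - ∑ i ∈ Finset.range N, c i * π ^ i ∈ Ideal.span {π ^ N} := by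
    intro N s hs
    rw [← Finset.sum_sdiff hs, add_sub_cancel_right]
    refine Ideal.sum_mem _ fun i hi => ?_
    have hi' : N ≤ i := by simpa using (Finset.mem_sdiff.1 hi).2
    exact Ideal.mul_mem_left _ _ (Ideal.mem_span_singleton.2 (pow_dvd_pow _ hi'))
  constructor
  · intro h N
    refine (hcl N).mem_of_tendsto (h.sub_const _) ?_
    filter_upwards [eventually_ge_atTop (Finset.range N)] with s hs using hmem N s hs
  · intro h
    rw [HasSum, SummationFilter.unconditional_filter, ← tendsto_sub_nhds_zero_iff]
    intro U hU
    obtain ⟨N, hN⟩ : ∃ N, ((Ideal.span {π ^ N} : Ideal 𝒪[F]) : Set 𝒪[F]) ⊆ U := by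
      refine exists_subset_nhds_of_isCompact (directed_of_isDirected_le ?_)
        (fun N => (hcl N).isCompact) ?_
      · intro m n hmn
        exact Ideal.span_singleton_le_span_singleton.2 (pow_dvd_pow _ hmn)
      · intro y hy
        have hb := Ideal.iInf_pow_eq_bot_of_isLocalRing (Ideal.span {π})
          (by rw [Ne, Ideal.span_singleton_eq_top]; exact hπ.not_isUnit)
        have : y ∈ ⨅ i, Ideal.span {π} ^ i := by
          simp only [Ideal.mem_iInf, Ideal.span_singleton_pow]
          exact fun i => Set.mem_iInter.1 hy i
        rw [hb, Ideal.mem_bot] at this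
        rwa [this]
    rw [mem_map]
    filter_upwards [eventually_ge_atTop (Finset.range N)] with s hs
    refine hN ?_
    have := sub_mem (hmem N s hs) (h N)
    simpa using this

/-- The subgroup `supp p π k` is compact, being a projection of a closed subset of a compact
space. -/
theorem compactSpace_supp (hπ : Irreducible π) (k : ℕ) : CompactSpace (supp p π k) := by
  have := t2Space F
  let T : Set ((ℕ → 𝒪[F]) × 𝒪[F]) := {z | (∀ i, z.1 i ^ Nat.card 𝓀[F] = z.1 i) ∧
    (∀ i, ¬ p ^ k ∣ i → z.1 i = 0) ∧
      ∀ N, z.2 - ∑ i ∈ Finset.range N, z.1 i * π ^ i ∈ Ideal.span {π ^ N}}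
  have hT : IsClosed T := by
    have h1 : IsClosed {z : (ℕ → 𝒪[F]) × 𝒪[F] | ∀ i, z.1 i ^ Nat.card 𝓀[F] = z.1 i} := by
      simp only [Set.ofPred_forall]
      exact isClosed_iInter fun i => isClosed_eq (by fun_prop) (by fun_prop)
    have h2 : IsClosed {z : (ℕ → 𝒪[F]) × 𝒪[F] | ∀ i, ¬ p ^ k ∣ i → z.1 i = 0} := by
      simp only [Set.ofPred_forall]
      exact isClosed_iInter fun i => isClosed_iInter fun _ => isClosed_eq (by fun_prop) (by fun_prop)
    have h3 : IsClosed {z : (ℕ → 𝒪[F]) × 𝒪[F] |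
        ∀ N, z.2 - ∑ i ∈ Finset.range N, z.1 i * π ^ i ∈ Ideal.span {π ^ N}} := by
      simp only [Set.ofPred_forall]
      refine isClosed_iInter fun N => ?_
      exact (IsNoetherianRing.isClosed_ideal (Ideal.span {π ^ N})).preimage
        (f := fun z : (ℕ → 𝒪[F]) × 𝒪[F] => z.2 - ∑ i ∈ Finset.range N, z.1 i * π ^ i)
        (by fun_prop)
    exact h1.inter (h2.inter h3)
  have himg : ((supp p π k : AddSubgroup 𝒪[F]) : Set 𝒪[F]) = Prod.snd '' T := by
    ext x
    constructor
    · rintro ⟨c, h1, h2, h3⟩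
      exact ⟨(c, x), ⟨h1, h2, (hasSum_digits_iff hπ c x).1 h3⟩, rfl⟩
    · rintro ⟨⟨c, y⟩, ⟨h1, h2, h3⟩, rfl⟩
      exact ⟨c, h1, h2, (hasSum_digits_iff hπ c y).2 h3⟩
  refine isCompact_iff_compactSpace.1 ?_
  rw [himg]
  exact hT.isCompact.image continuous_snd

variable [MeasurableSpace F] [BorelSpace F]

/-- The measure `μ_k`: the normalised Haar measure of the compact group `supp p π k`. -/
noncomputable def haarSupp (hπ : Irreducible π) (k : ℕ) : Measure (supp p π k) :=
  haveI := compactSpace_supp p hπ k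
  haarProb (supp p π k)

/-- The measure `μ* = (1 - 1/p) (μ + ∑_{k ≥ 1} p ^ (-k) μ_k)` on `𝒪`, where `μ` is the normalised
Haar measure of `𝒪` and `μ_k` is regarded as a measure on `𝒪`. -/
noncomputable def weightedMeasure (hπ : Irreducible π) : Measure 𝒪[F] :=
  ENNReal.ofReal (1 - 1 / (p : ℝ)) • (haarProb 𝒪[F] +
    Measure.sum fun k : ℕ => ((p : ℝ≥0∞) ^ (k + 1))⁻¹ •
      (haarSupp p hπ (k + 1)).map (Subtype.val : supp p π (k + 1) → 𝒪[F]))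

end Field
end LocalFieldPowers

/-!
The proof rests on three facts about the powers of an element `x` with `|x| > 1`.

**Frobenius.** As an additive group, `F` is the direct sum of `𝒪` and of the finite sums
`∑_{n < 0} c_n π ^ n`; the integral part is the projection to `𝒪`. Both summands are stable under
`y ↦ y ^ p`, so `[x ^ (p ^ k m)] = [x ^ m] ^ (p ^ k)` (`intPart_pow_char_pow`). The map
`y ↦ y ^ (p ^ k)` is a continuous surjective homomorphism from `𝒪` to the group `supp p π k`, hence
takes Haar measure to Haar measure (`map_frobeniusToSupp`). So everything about exponents that are
exactly divisible by `p ^ k` follows from the case of exponents prime to `p`.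

**Expansion and independence.** Write `|x| = |π| ^ (-d)`. For `p ∤ m`, the derivative `m x ^ (m - 1)`
does not vanish, and `x ↦ x ^ m` maps a small ball around `x` bijectively onto a translate of `𝒪`,
scaling all distances by a constant (`isExpanding_intPart_pow`). So `[x ^ m]` is exactly Haar
distributed on such a ball, while the first `L` digits of `[x ^ n]` are constant there as soon as
`n + L ≤ m`. Consequently the first `L` digits of `[x ^ m]` and of `[x ^ n]` are independent
(`IsExpanding.haarProb_inter`), and along each residue class of exponents modulo `p L` that is prime
to `p` the strong law of large numbers for pairwise independent variables applies. Adding up the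
residue classes and approximating continuous functions by functions of finitely many digits gives,
for almost every `x`, uniform distribution along the exponents prime to `p` (`ae_isUDPrimeTo`).

**Densities.** The exponents exactly divisible by `p ^ k` have density `(1 - 1/p) p ^ (-k)`, which is
the weight of `μ_k` in `μ*`, and those divisible by `p ^ K` contribute at most `p ^ (-K)`
(`isUD_weightedMeasure`). Finally, a proportion `1 / p` of all exponents is divisible by `p`, so for
every `x` this proportion of the sequence consists of `p`-th powers, which lie in a clopen set of
measure less than `1 / p`. This excludes uniform distribution for `μ` (`not_isUD_haarProb`).
-/

namespace LocalFieldPowers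

/-! ### Digit expansions and the integral part -/

section Expansions

variable {F : Type*} [Field F] [ValuativeRel F] {π : 𝒪[F]}

theorem coe_ne_zero_of_irreducible (hπ : Irreducible π) : (π : F) ≠ 0 :=
  fun h => hπ.ne_zero (Subtype.ext h)

variable [TopologicalSpace F] [IsNonarchimedeanLocalField F]
variable (p : ℕ) [Fact p.Prime] [CharP F p]

theorem eq_zero_of_mem_constants_of_dvd (hπ : Irreducible π) {c : 𝒪[F]} (hc : c ∈ constants F p)
    (h : π ∣ c) : c = 0 := by
  by_contra h0
  have hc' : c ^ Nat.card 𝓀[F] = c := hc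
  have hq : 1 < Nat.card 𝓀[F] := Finite.one_lt_card
  obtain ⟨r, hr⟩ := Nat.exists_eq_add_of_lt hq
  have h1 : c ^ (r + 1) = 1 := by
    refine mul_left_cancel₀ h0 ?_
    rw [← pow_succ', mul_one]
    convert hc' using 2
    omega
  exact hπ.not_isUnit (isUnit_of_dvd_unit h (IsUnit.of_pow_eq_one h1 (by omega)))

/-- Every residue class contains a digit: by Hensel's lemma, `X ^ q - X` has a root above each
element of the residue field. -/
theorem exists_mem_constants_dvd_sub (hπ : Irreducible π) (a : 𝒪[F]) :
    ∃ c ∈ constants F p, π ∣ a - c := by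
  let := IsTopologicalAddGroup.rightUniformSpace F
  have := isUniformAddGroup_of_addCommGroup (G := F)
  have hH : HenselianRing 𝒪[F] 𝓂[F] := inferInstance
  have hq : 1 < Nat.card 𝓀[F] := Finite.one_lt_card
  have hq0 : ((Nat.card 𝓀[F] : ℕ) : 𝒪[F]) = 0 := by
    obtain ⟨n, hn⟩ := exists_card_eq F p
    have hn0 : n ≠ 0 := by
      rintro rfl
      simp [hn] at hq
    rw [hn, Nat.cast_pow, CharP.cast_eq_zero, zero_pow hn0]
  obtain ⟨c, hc, hca⟩ := hH.is_henselian (Polynomial.X ^ Nat.card 𝓀[F] - Polynomial.X)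
    (Polynomial.monic_X_pow_sub (by
      rw [Polynomial.degree_X]
      exact_mod_cast hq)) a (by
      have := Fintype.ofFinite 𝓀[F]
      rw [← IsLocalRing.residue_eq_zero_iff]
      simp only [Polynomial.eval_sub, Polynomial.eval_pow, Polynomial.eval_X, map_sub, map_pow]
      rw [Nat.card_eq_fintype_card, FiniteField.pow_card, sub_self]) (by
      simp [Polynomial.derivative_X_pow, hq0])
  refine ⟨c, ?_, ?_⟩
  · have : c ^ Nat.card 𝓀[F] - c = 0 := by simpa using hc
    exact sub_eq_zero.1 this
  · rw [hπ.maximalIdeal_eq, Ideal.mem_span_singleton] at hca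
    rw [← neg_sub]
    exact (dvd_neg).2 hca

theorem exists_hasSum_digits (hπ : Irreducible π) (a : 𝒪[F]) :
    ∃ c : ℕ → 𝒪[F], (∀ i, c i ∈ constants F p) ∧ HasSum (fun i => c i * π ^ i) a := by
  choose c hc d hd using exists_mem_constants_dvd_sub p (F := F) hπ
  refine ⟨fun i => c (d^[i] a), fun i => hc _, (hasSum_digits_iff hπ _ _).2 fun N => ?_⟩
  have key : a - ∑ i ∈ Finset.range N, c (d^[i] a) * π ^ i = π ^ N * d^[N] a := by
    induction N with
    | zero => simp
    | succ N ih =>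
      rw [Finset.sum_range_succ, ← sub_sub, ih, Function.iterate_succ_apply', pow_succ, mul_assoc,
        ← hd]
      ring
  rw [key]
  exact Ideal.mem_span_singleton.2 (dvd_mul_right _ _)

/-- Any sequence of coefficients gives a convergent series. -/
theorem exists_hasSum_mul_pow (hπ : Irreducible π) (c : ℕ → 𝒪[F]) :
    ∃ a, HasSum (fun i => c i * π ^ i) a := by
  have := t2Space F
  let S : ℕ → Set 𝒪[F] := fun N =>
    {a | a - ∑ i ∈ Finset.range N, c i * π ^ i ∈ Ideal.span {π ^ N}}
  have hS : ∀ N, IsClosed (S N) := fun N =>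
    (IsNoetherianRing.isClosed_ideal (Ideal.span {π ^ N})).preimage
      (f := fun a : 𝒪[F] => a - ∑ i ∈ Finset.range N, c i * π ^ i) (by fun_prop)
  obtain ⟨a, ha⟩ := (hS 0).isCompact.nonempty_iInter_of_sequence_nonempty_isCompact_isClosed S
    (fun N a ha => by
      have h1 : a - ∑ i ∈ Finset.range (N + 1), c i * π ^ i ∈ Ideal.span {π ^ (N + 1)} := ha
      have h2 := Ideal.span_singleton_le_span_singleton.2 (pow_dvd_pow π N.le_succ) h1
      have h3 : c N * π ^ N ∈ Ideal.span {π ^ N} :=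
        Ideal.mem_span_singleton.2 (dvd_mul_left _ _)
      have h4 := add_mem h2 h3
      rw [Finset.sum_range_succ] at h4
      show a - ∑ i ∈ Finset.range N, c i * π ^ i ∈ Ideal.span {π ^ N}
      convert h4 using 1
      ring)
    (fun N => ⟨∑ i ∈ Finset.range N, c i * π ^ i, by simp [S]⟩) hS
  exact ⟨a, (hasSum_digits_iff hπ _ _).2 fun N => Set.mem_iInter.1 ha N⟩

theorem exists_eq_coe_div_pow (hπ : Irreducible π) (x : F) :
    ∃ (a : 𝒪[F]) (n : ℕ), x = a / (π : F) ^ n := by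
  obtain ⟨a, b, hb, rfl⟩ := IsFractionRing.div_surjective (A := 𝒪[F]) x
  obtain ⟨n, u, rfl⟩ :=
    IsDiscreteValuationRing.eq_unit_mul_pow_irreducible (nonZeroDivisors.ne_zero hb) hπ
  refine ⟨a * (u⁻¹ : 𝒪[F]ˣ), n, ?_⟩
  have h1 : ((u : 𝒪[F]) : F) * ((u⁻¹ : 𝒪[F]ˣ) : 𝒪[F]) = 1 := by
    rw [← MulMemClass.coe_mul, Units.mul_inv]
    rfl
  have h2 : ((u : 𝒪[F]) : F) ≠ 0 := left_ne_zero_of_mul_eq_one h1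
  have h3 := pow_ne_zero n (coe_ne_zero_of_irreducible hπ)
  show (a : F) / (((u : 𝒪[F]) : F) * (π : F) ^ n) = (a : F) * _ / _
  rw [div_eq_div_iff (mul_ne_zero h2 h3) h3]
  linear_combination (-(a : F) * (π : F) ^ n) * h1

/-- An element of absolute value greater than `1` is a unit times a negative power of `π`. -/
theorem exists_unit_mul_pow_eq_one (hπ : Irreducible π) {x : F} (hx : 1 < valuation F x) :
    ∃ (d : ℕ) (u : 𝒪[F]ˣ), 1 ≤ d ∧ x * (π : F) ^ d = (u : 𝒪[F]) := by
  have hx0 : x ≠ 0 := by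
    rintro rfl
    simp at hx
  have hinv : valuation F x⁻¹ < 1 := by
    rw [map_inv₀]
    exact inv_lt_one_of_one_lt₀ hx
  let y : 𝒪[F] := ⟨x⁻¹, hinv.le⟩
  have hy0 : y ≠ 0 := fun h => inv_ne_zero hx0 (congrArg Subtype.val h)
  obtain ⟨d, u, hu⟩ := IsDiscreteValuationRing.eq_unit_mul_pow_irreducible hy0 hπ
  have hu' : x⁻¹ = ((u : 𝒪[F]) : F) * (π : F) ^ d := congrArg Subtype.val hu
  have h1 : ((u : 𝒪[F]) : F) * ((u⁻¹ : 𝒪[F]ˣ) : 𝒪[F]) = 1 := by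
    rw [← MulMemClass.coe_mul, Units.mul_inv]
    rfl
  refine ⟨d, u⁻¹, ?_, ?_⟩
  · rcases Nat.eq_zero_or_pos d with rfl | hd
    · exfalso
      rw [pow_zero, mul_one] at hu'
      have h2 : x = ((u⁻¹ : 𝒪[F]ˣ) : 𝒪[F]) := by
        rw [← inv_inv x, hu']
        exact inv_eq_of_mul_eq_one_right h1
      have h3 : valuation F x ≤ 1 := by
        rw [h2]
        exact ((u⁻¹ : 𝒪[F]ˣ) : 𝒪[F]).2
      exact absurd hx h3.not_gt
    · exact hd
  · have h2 : x * (((u : 𝒪[F]) : F) * (π : F) ^ d) = 1 := by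
      rw [← hu', mul_inv_cancel₀ hx0]
    linear_combination (((u⁻¹ : 𝒪[F]ˣ) : 𝒪[F]) : F) * h2 - x * (π : F) ^ d * h1

theorem exists_isExpansion (hπ : Irreducible π) (x : F) : ∃ c, IsExpansion p π x c := by
  have hπ0 := coe_ne_zero_of_irreducible hπ
  obtain ⟨a, v, rfl⟩ := exists_eq_coe_div_pow hπ x
  obtain ⟨c, hc, hsum⟩ := exists_hasSum_digits p hπ a
  refine ⟨fun n => if n < -(v : ℤ) then 0 else c (n + v).toNat, fun n => ?_, ⟨-v, fun n hn => ?_⟩,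
    ?_⟩
  · dsimp only
    split_ifs
    · exact zero_mem _
    · exact hc _
  · simp [hn]
  · have h1 : HasSum (fun i => ((c i * π ^ i : 𝒪[F]) : F)) (a : F) :=
      hsum.map (𝒪[F].subtype) continuous_subtype_val
    have h2 := h1.div_const ((π : F) ^ v)
    let g : ℕ → ℤ := fun i => (i : ℤ) - v
    have hg : Function.Injective g := fun i j hij => by
      simp only [g] at hij
      omega
    refine (hg.hasSum_iff ?_).1 (h2.congr_fun ?_)
    · intro n hn
      have : n < -(v : ℤ) := by
        by_contra hlt
        exact hn ⟨(n + v).toNat, by simp only [g]; omega⟩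
      simp [this]
    · intro i
      have h3 : ¬ ((i : ℤ) - v < -(v : ℤ)) := by omega
      simp only [g, Function.comp_apply, h3, if_false, sub_add_cancel, Int.toNat_natCast]
      rw [zpow_sub₀ hπ0, zpow_natCast, zpow_natCast]
      simp [mul_div_assoc]

variable (π) in
/-- The additive group of the finite sums `∑_{n < 0} c_n π ^ n` with digits `c_n`, that is, the
values at `π⁻¹` of the polynomials over `𝔽_q` without constant term. -/
noncomputable def polarParts : AddSubgroup F :=
  (Submodule.toAddSubgroup (Ideal.span {(Polynomial.X : Polynomial (constants F p))})).map
    (Polynomial.eval₂RingHom ((𝒪[F].subtype).comp (constants F p).subtype)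
      ((π : F)⁻¹)).toAddMonoidHom

variable {p}

theorem mem_polarParts {x : F} : x ∈ polarParts π p ↔ ∃ P : Polynomial (constants F p),
    Polynomial.eval₂ ((𝒪[F].subtype).comp (constants F p).subtype) ((π : F)⁻¹)
      (Polynomial.X * P) = x := by
  simp only [polarParts, AddSubgroup.mem_map, Submodule.mem_toAddSubgroup,
    Ideal.mem_span_singleton]
  constructor
  · rintro ⟨_, ⟨P, rfl⟩, h⟩
    exact ⟨P, h⟩
  · rintro ⟨P, h⟩
    exact ⟨_, ⟨P, rfl⟩, h⟩

theorem pow_mem_polarParts {x : F} (hx : x ∈ polarParts π p) {n : ℕ} (hn : n ≠ 0) :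
    x ^ n ∈ polarParts π p := by
  obtain ⟨P, rfl⟩ := mem_polarParts.1 hx
  obtain ⟨m, rfl⟩ := Nat.exists_eq_succ_of_ne_zero hn
  refine mem_polarParts.2 ⟨P * (Polynomial.X * P) ^ m, ?_⟩
  rw [← mul_assoc, ← pow_succ', Polynomial.eval₂_pow]

theorem coe_mul_zpow_mem_polarParts {c : 𝒪[F]} (hc : c ∈ constants F p) {n : ℤ} (hn : n < 0) :
    (c : F) * (π : F) ^ n ∈ polarParts π p := by
  obtain ⟨m, rfl⟩ := Int.exists_eq_neg_ofNat hn.le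
  obtain ⟨k, rfl⟩ : ∃ k, m = k + 1 := ⟨m - 1, by omega⟩
  refine mem_polarParts.2 ⟨Polynomial.C ⟨c, hc⟩ * Polynomial.X ^ k, ?_⟩
  simp only [Polynomial.eval₂_mul, Polynomial.eval₂_X, Polynomial.eval₂_C, Polynomial.eval₂_X_pow]
  rw [zpow_neg, zpow_natCast, ← inv_pow, pow_succ]
  show _ * ((c : F) * _) = _
  ring

/-- A nonzero element of `polarParts π p` has a pole: its leading digit is a unit. -/
theorem eq_zero_of_coe_mem_polarParts (hπ : Irreducible π) {a : 𝒪[F]}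
    (ha : (a : F) ∈ polarParts π p) : a = 0 := by
  have hπ0 := coe_ne_zero_of_irreducible hπ
  obtain ⟨P, hP⟩ := mem_polarParts.1 ha
  suffices P = 0 by
    rw [this, mul_zero, Polynomial.eval₂_zero] at hP
    exact Subtype.ext hP.symm
  by_contra h0
  let φ := (𝒪[F].subtype).comp (constants F p).subtype
  -- Multiplication by `π ^ (deg P + 1)` turns the equation into a congruence for the leading digit.
  have h1 : (((P.leadingCoeff : 𝒪[F]) + ∑ i ∈ Finset.range P.natDegree,
      (P.coeff i : 𝒪[F]) * π ^ (P.natDegree - i) : 𝒪[F]) : F) =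
      ((a * π ^ (P.natDegree + 1) : 𝒪[F]) : F) := by
    rw [Polynomial.eval₂_mul, Polynomial.eval₂_X, Polynomial.eval₂_eq_sum_range,
      Finset.sum_range_succ] at hP
    have h2 : (a : F) * (π : F) ^ (P.natDegree + 1) = (∑ i ∈ Finset.range P.natDegree,
        φ (P.coeff i) * (π : F)⁻¹ ^ i + φ (P.coeff P.natDegree) * (π : F)⁻¹ ^ P.natDegree) *
          (π : F) ^ P.natDegree := by
      rw [← hP, pow_succ', mul_comm (π : F)⁻¹, mul_assoc, inv_mul_cancel_left₀ hπ0]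
    push_cast
    rw [h2, add_mul, mul_assoc, ← mul_pow, inv_mul_cancel₀ hπ0, one_pow, mul_one, add_comm,
      Finset.sum_mul]
    congr 1
    refine Finset.sum_congr rfl fun i hi => ?_
    have hi' : i ≤ P.natDegree := (Finset.mem_range.1 hi).le
    show ((P.coeff i : 𝒪[F]) : F) * _ = ((P.coeff i : 𝒪[F]) : F) * _ * _
    rw [mul_assoc, inv_pow, pow_sub₀ _ hπ0 hi', mul_comm ((π : F) ^ P.natDegree)]
  have h2 := Subtype.ext h1
  have h3 : π ∣ (P.leadingCoeff : 𝒪[F]) := by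
    rw [← eq_sub_iff_add_eq] at h2
    rw [h2]
    refine dvd_sub ?_ (Finset.dvd_sum fun i hi => ?_)
    · exact (dvd_pow_self π (Nat.succ_ne_zero _)).mul_left _
    · refine (dvd_pow_self π ?_).mul_left _
      have := Finset.mem_range.1 hi
      omega
  have h4 := eq_zero_of_mem_constants_of_dvd p hπ P.leadingCoeff.2 h3
  exact h0 (Polynomial.leadingCoeff_eq_zero.1 (Subtype.ext h4))

theorem IsExpansion.sub_tsum_mem_polarParts {x : F} {c : ℤ → 𝒪[F]}
    (h : IsExpansion p π x c) : x - (∑' n : ℕ, c n * π ^ n : 𝒪[F]) ∈ polarParts π p := by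
  have := t2Space F
  obtain ⟨hc, ⟨v, hv⟩, hsum⟩ := h
  let f : ℤ → F := fun n => (c n : F) * (π : F) ^ n
  have h1 : HasSum (fun n => if n < 0 then f n else 0) (∑ n ∈ Finset.Ico v 0, f n) := by
    have : ∑ n ∈ Finset.Ico v 0, f n = ∑ n ∈ Finset.Ico v 0, if n < 0 then f n else 0 :=
      Finset.sum_congr rfl fun n hn => by rw [if_pos (Finset.mem_Ico.1 hn).2]
    rw [this]
    refine hasSum_sum_of_ne_finset_zero fun n hn => ?_
    split_ifs with h0
    · have : n < v := by
        by_contra hlt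
        exact hn (Finset.mem_Ico.2 ⟨not_lt.1 hlt, h0⟩)
      simp [f, hv n this]
    · rfl
  have h2 : HasSum (fun n => if n < 0 then 0 else f n) (x - ∑ n ∈ Finset.Ico v 0, f n) := by
    refine (hsum.sub h1).congr_fun fun n => ?_
    split_ifs <;> simp [f]
  have h3 : HasSum (fun n : ℕ => ((c n * π ^ n : 𝒪[F]) : F))
      (x - ∑ n ∈ Finset.Ico v 0, f n) := by
    rw [← (Nat.cast_injective (R := ℤ)).hasSum_iff] at h2
    · refine h2.congr_fun fun n => ?_
      simp [f]
    · intro n hn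
      have : n < 0 := by
        by_contra hlt
        exact hn ⟨n.toNat, by simp; omega⟩
      simp [this]
  have hcl : IsClosed (𝒪[F] : Set F) :=
    (isCompact_iff_compactSpace.2 (inferInstance : CompactSpace 𝒪[F])).isClosed
  have h4 : x - ∑ n ∈ Finset.Ico v 0, f n ∈ 𝒪[F] :=
    hcl.mem_of_tendsto h3 (Eventually.of_forall fun s => sum_mem fun i _ => SetLike.coe_mem _)
  have h5 : HasSum (fun n : ℕ => c n * π ^ n) (⟨_, h4⟩ : 𝒪[F]) :=
    (Topology.IsInducing.subtypeVal.hasSum_iff (g := 𝒪[F].subtype) _ _).1 h3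
  rw [h5.tsum_eq]
  simp only [sub_sub_cancel]
  exact sum_mem fun n hn => coe_mul_zpow_mem_polarParts (hc n) (Finset.mem_Ico.1 hn).2

theorem sub_intPart_mem_polarParts (hπ : Irreducible π) (x : F) :
    x - intPart p π x ∈ polarParts π p := by
  have h := exists_isExpansion p hπ x
  have h1 : IsExpansion p π x (digits p π x) := by
    rw [digits, dif_pos h]
    exact h.choose_spec
  exact h1.sub_tsum_mem_polarParts

/-- The integral part is the projection along the decomposition of the additive group of `F` as
the direct sum of `polarParts π p` and `𝒪`. -/
theorem intPart_eq_of_sub_mem_polarParts (hπ : Irreducible π) {x : F} {a : 𝒪[F]}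
    (h : x - a ∈ polarParts π p) : intPart p π x = a := by
  have h1 := sub_mem h (sub_intPart_mem_polarParts (p := p) hπ x)
  rw [sub_sub_sub_cancel_left] at h1
  exact sub_eq_zero.1 (eq_zero_of_coe_mem_polarParts hπ (a := intPart p π x - a)
    (by simpa using h1))

theorem intPart_add_coe (hπ : Irreducible π) (x : F) (a : 𝒪[F]) :
    intPart p π (x + a) = intPart p π x + a := by
  refine intPart_eq_of_sub_mem_polarParts hπ ?_
  have := sub_intPart_mem_polarParts (p := p) hπ x
  push_cast
  rwa [add_sub_add_right_eq_sub]

/-- The integral part commutes with the Frobenius endomorphism. -/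
theorem intPart_pow_char_pow (hπ : Irreducible π) (x : F) (k : ℕ) :
    intPart p π (x ^ p ^ k) = intPart p π x ^ p ^ k := by
  refine intPart_eq_of_sub_mem_polarParts hπ ?_
  have h := pow_mem_polarParts (sub_intPart_mem_polarParts (p := p) hπ x)
    (pow_ne_zero k (Fact.out : p.Prime).ne_zero)
  push_cast
  rwa [sub_pow_char_pow] at h

end Expansions

/-! ### The normalised Haar measure -/

section HaarProb

variable (G : Type*) [AddGroup G] [TopologicalSpace G] [IsTopologicalAddGroup G]
  [CompactSpace G] [MeasurableSpace G] [BorelSpace G]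

instance isAddHaarMeasure_haarProb : (haarProb G).IsAddHaarMeasure := by
  unfold haarProb
  infer_instance

instance isProbabilityMeasure_haarProb : IsProbabilityMeasure (haarProb G) :=
  ⟨Measure.addHaarMeasure_self⟩

end HaarProb

/-! ### Haar measure on the images of Frobenius -/

section FrobeniusImage

variable {F : Type*} [Field F] [ValuativeRel F] [TopologicalSpace F] [IsNonarchimedeanLocalField F]
variable (p : ℕ) [Fact p.Prime] [CharP F p] {π : 𝒪[F]}

theorem hasSum_digits_pow_char_pow {c : ℕ → 𝒪[F]} {y : 𝒪[F]}
    (h : HasSum (fun i => c i * π ^ i) y) (k : ℕ) :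
    HasSum (fun j => (if p ^ k ∣ j then c (j / p ^ k) ^ p ^ k else 0) * π ^ j) (y ^ p ^ k) := by
  have hp : 0 < p ^ k := pow_pos (Fact.out : p.Prime).pos k
  have h1 : HasSum (fun i => (c i * π ^ i) ^ p ^ k) (y ^ p ^ k) :=
    h.map (iterateFrobenius 𝒪[F] p k) (continuous_pow (p ^ k))
  have hinj : Function.Injective fun i => p ^ k * i := fun i j h => Nat.eq_of_mul_eq_mul_left hp h
  refine (hinj.hasSum_iff ?_).1 (h1.congr_fun fun i => ?_)
  · intro j hj
    rw [if_neg, zero_mul]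
    rintro ⟨i, rfl⟩
    exact hj ⟨i, rfl⟩
  · simp only [Function.comp_apply, dvd_mul_right, if_true, Nat.mul_div_cancel_left _ hp]
    rw [mul_pow, ← pow_mul, mul_comm i]

theorem pow_char_pow_mem_supp (hπ : Irreducible π) (y : 𝒪[F]) (k : ℕ) :
    y ^ p ^ k ∈ supp p π k := by
  obtain ⟨c, hc, hsum⟩ := exists_hasSum_digits p hπ y
  refine ⟨_, fun j => ?_, fun j hj => if_neg hj, hasSum_digits_pow_char_pow p hsum k⟩
  split_ifs
  · exact pow_mem (hc _) _
  · exact zero_mem _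

theorem exists_pow_char_pow_eq_of_mem_constants {d : 𝒪[F]} (hd : d ∈ constants F p) (k : ℕ) :
    ∃ e ∈ constants F p, e ^ p ^ k = d := by
  obtain ⟨n, hn⟩ := exists_card_eq F p
  have hn0 : n ≠ 0 := by
    rintro rfl
    have hq : 1 < Nat.card 𝓀[F] := Finite.one_lt_card
    simp [hn] at hq
  have hd' : d ^ p ^ n = d := by
    rw [← hn]
    exact hd
  have hiter : ∀ j, d ^ p ^ (n * j) = d := by
    intro j
    induction j with
    | zero => simp
    | succ j ih => rw [Nat.mul_succ, pow_add, pow_mul, ih, hd']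
  refine ⟨d ^ p ^ (n * k - k), pow_mem hd _, ?_⟩
  rw [← pow_mul, ← pow_add, Nat.sub_add_cancel (Nat.le_mul_of_pos_left k (Nat.pos_of_ne_zero hn0)),
    hiter]

/-- The `k`-fold Frobenius endomorphism of `𝒪`, as a map to its image `supp p π k`. -/
noncomputable def frobeniusToSupp (hπ : Irreducible π) (k : ℕ) : 𝒪[F] →+ supp p π k :=
  ((iterateFrobenius 𝒪[F] p k).toAddMonoidHom).codRestrict (supp p π k)
    fun y => pow_char_pow_mem_supp p hπ y k

@[simp]
theorem coe_frobeniusToSupp (hπ : Irreducible π) (k : ℕ) (y : 𝒪[F]) :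
    (frobeniusToSupp p hπ k y : 𝒪[F]) = y ^ p ^ k :=
  rfl

theorem continuous_frobeniusToSupp (hπ : Irreducible π) (k : ℕ) :
    Continuous (frobeniusToSupp p hπ k) :=
  (continuous_pow (p ^ k)).subtype_mk _

theorem surjective_frobeniusToSupp (hπ : Irreducible π) (k : ℕ) :
    Function.Surjective (frobeniusToSupp p hπ k) := by
  have := t2Space F
  have hp : 0 < p ^ k := pow_pos (Fact.out : p.Prime).pos k
  rintro ⟨z, d, hd, hd0, hz⟩
  choose e he hed using fun i => exists_pow_char_pow_eq_of_mem_constants p (hd i) k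
  obtain ⟨y, hy⟩ := exists_hasSum_mul_pow hπ fun i => e (p ^ k * i)
  refine ⟨y, Subtype.ext ?_⟩
  refine (hasSum_digits_pow_char_pow p hy k).unique (hz.congr_fun fun j => ?_)
  by_cases hj : p ^ k ∣ j
  · rw [if_pos hj, Nat.mul_div_cancel' hj, hed]
  · rw [if_neg hj, hd0 j hj]

variable [MeasurableSpace F] [BorelSpace F]

theorem map_frobeniusToSupp (hπ : Irreducible π) (k : ℕ) :
    (haarProb 𝒪[F]).map (frobeniusToSupp p hπ k) = haarSupp p hπ k := by
  have := t2Space F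
  have := compactSpace_supp p hπ k
  have hcont := continuous_frobeniusToSupp p hπ k
  have h1 : ((haarProb 𝒪[F]).map (frobeniusToSupp p hπ k)).IsAddHaarMeasure :=
    Measure.isAddHaarMeasure_map _ _ hcont (surjective_frobeniusToSupp p hπ k) (by
      rw [cocompact_eq_bot, cocompact_eq_bot]
      exact tendsto_bot)
  have h2 : IsProbabilityMeasure ((haarProb 𝒪[F]).map (frobeniusToSupp p hπ k)) :=
    Measure.isProbabilityMeasure_map hcont.aemeasurable
  have h3 : (haarSupp p hπ k).IsAddHaarMeasure := isAddHaarMeasure_haarProb _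
  have h4 : IsProbabilityMeasure (haarSupp p hπ k) := isProbabilityMeasure_haarProb _
  exact Measure.isAddHaarMeasure_eq_of_isProbabilityMeasure _ _

theorem integral_haarSupp (hπ : Irreducible π) (k : ℕ) (f : C(supp p π k, ℝ)) :
    ∫ z, f z ∂haarSupp p hπ k = ∫ y, f (frobeniusToSupp p hπ k y) ∂haarProb 𝒪[F] := by
  rw [← map_frobeniusToSupp p hπ k]
  exact integral_map (continuous_frobeniusToSupp p hπ k).aemeasurable
    f.continuous.aestronglyMeasurable

end FrobeniusImage

/-! ### Frequencies of pairwise independent events -/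

section StrongLaw

open ProbabilityTheory

/-- The strong law of large numbers for the frequency of pairwise independent events of equal
probability. -/
theorem ae_tendsto_average_indicator {Ω : Type*} [MeasurableSpace Ω] (μ : Measure Ω)
    [IsProbabilityMeasure μ] (E : ℕ → Set Ω) (hE : ∀ i, MeasurableSet (E i)) {m : ℝ≥0∞}
    (hm : ∀ i, μ (E i) = m) (hind : ∀ i j, i < j → μ (E i ∩ E j) = μ (E i) * μ (E j)) :
    ∀ᵐ ω ∂μ, Tendsto (fun N : ℕ => (N : ℝ)⁻¹ * ∑ i ∈ Finset.range N, (E i).indicator 1 ω) atTop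
      (𝓝 m.toReal) := by
  have hmeas : ∀ i, Measurable ((E i).indicator (1 : Ω → ℝ)) := fun i =>
    measurable_one.indicator (hE i)
  have hindep : ∀ i j, i < j →
      IndepFun ((E i).indicator (1 : Ω → ℝ)) ((E j).indicator (1 : Ω → ℝ)) μ := by
    intro i j hij
    have h1 : IndepSet (E i) (E j) μ :=
      (indepSet_iff_measure_inter_eq_mul (hE i) (hE j) μ).2 (hind i j hij)
    have hle : ∀ i, MeasurableSpace.comap ((E i).indicator (1 : Ω → ℝ)) inferInstance ≤
        MeasurableSpace.generateFrom {E i} := fun i =>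
      Measurable.comap_le (Measurable.indicator
        (@measurable_one _ _ _ (MeasurableSpace.generateFrom {E i}) _)
        (MeasurableSpace.measurableSet_generateFrom (Set.mem_singleton _)))
    exact indep_of_indep_of_le_left (indep_of_indep_of_le_right h1 (hle j)) (hle i)
  have hident : ∀ i, IdentDistrib ((E i).indicator (1 : Ω → ℝ)) ((E 0).indicator (1 : Ω → ℝ)) μ μ :=
    fun i => ⟨(hmeas i).aemeasurable, (hmeas 0).aemeasurable, by
      classical
      ext s hs
      rw [Measure.map_apply (hmeas i) hs, Measure.map_apply (hmeas 0) hs]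
      have h1 : ∀ i, (E i).indicator (1 : Ω → ℝ) ⁻¹' s =
          (if (1 : ℝ) ∈ s then E i else ∅) ∪ (if (0 : ℝ) ∈ s then (E i)ᶜ else ∅) :=
        fun i => Set.indicator_const_preimage_eq_union _ _ _
      rw [h1, h1]
      split_ifs <;> simp [prob_compl_eq_one_sub, hE, hm]⟩
  have h := strong_law_ae_real (fun i => (E i).indicator (1 : Ω → ℝ))
    ((integrable_const (1 : ℝ)).indicator (hE 0))
    (fun i j hij => (lt_or_gt_of_ne hij).elim (hindep i j) fun h => (hindep j i h).symm) hident
  have h0 : ∫ ω, (E 0).indicator (1 : Ω → ℝ) ω ∂μ = m.toReal := by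
    rw [integral_indicator_one (hE 0), Measure.real, hm]
  rw [h0] at h
  filter_upwards [h] with ω hω
  simpa only [div_eq_inv_mul] using hω

end StrongLaw

/-! ### Cosets of the powers of the maximal ideal -/

section Cosets

variable {F : Type*} [Field F] [ValuativeRel F] {π : 𝒪[F]}

theorem setOf_pow_dvd_sub_out (L : ℕ) (c : 𝒪[F] ⧸ Ideal.span {π ^ L}) :
    {y : 𝒪[F] | π ^ L ∣ y - c.out} = Ideal.Quotient.mk (Ideal.span {π ^ L}) ⁻¹' {c} := by
  ext y
  have hc : Ideal.Quotient.mk (Ideal.span {π ^ L}) c.out = c := Ideal.Quotient.mk_out c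
  rw [Set.mem_preimage, Set.mem_singleton_iff, ← hc, Ideal.Quotient.mk_eq_mk_iff_sub_mem,
    Ideal.mem_span_singleton, hc]
  rfl

variable [TopologicalSpace F] [IsNonarchimedeanLocalField F]

theorem isOpen_setOf_pow_dvd_sub (hπ : Irreducible π) (n : ℕ) (c : 𝒪[F]) :
    IsOpen {o : 𝒪[F] | π ^ n ∣ o - c} := by
  have h0 : (valuation F).restrict ((π ^ n : 𝒪[F]) : F) ≠ 0 := by
    rw [map_ne_zero]
    exact fun h => pow_ne_zero n hπ.ne_zero (Subtype.ext h)
  have h1 : {o : 𝒪[F] | π ^ n ∣ o - c} =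
      (fun o : 𝒪[F] => ((o - c : 𝒪[F]) : F)) ⁻¹'
        {x | (valuation F).restrict x ≤ (valuation F).restrict ((π ^ n : 𝒪[F]) : F)} := by
    ext o
    simp only [Set.mem_preimage, Set.mem_ofPred_eq, Valuation.restrict_le_iff]
    exact (Valuation.integer.integers (valuation F)).dvd_iff_le
  rw [h1]
  exact ((valuation F).isOpen_closedBall h0).preimage (by fun_prop)

theorem finite_quotient_span_pow (hπ : Irreducible π) (n : ℕ) :
    Finite (𝒪[F] ⧸ Ideal.span {π ^ n}) := by
  refine AddSubgroup.quotient_finite_of_isOpen (Ideal.span {π ^ n}).toAddSubgroup ?_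
  convert! isOpen_setOf_pow_dvd_sub hπ n 0 using 1
  ext o
  simp [Ideal.mem_span_singleton]

variable [MeasurableSpace F] [BorelSpace F]

theorem measurableSet_setOf_pow_dvd_sub (hπ : Irreducible π) (n : ℕ) (c : 𝒪[F]) :
    MeasurableSet {o : 𝒪[F] | π ^ n ∣ o - c} :=
  (isOpen_setOf_pow_dvd_sub hπ n c).measurableSet

theorem haarProb_coset (n : ℕ) (c : 𝒪[F]) :
    haarProb 𝒪[F] {o | π ^ n ∣ o - c} = haarProb 𝒪[F] {o | π ^ n ∣ o} := by
  rw [← measure_preimage_add_right (haarProb 𝒪[F]) (-c) {o | π ^ n ∣ o}]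
  simp [sub_eq_add_neg]

/-- The preimages of the cosets of `π ^ n 𝒪`, through representatives, partition every set. -/
theorem sum_haarProb_inter_preimage_coset (n : ℕ) [Fintype (𝒪[F] ⧸ Ideal.span {π ^ n})]
    {Y : 𝒪[F] → 𝒪[F]} (hY : ∀ c, MeasurableSet {o | π ^ n ∣ Y o - c}) (A : Set 𝒪[F]) :
    ∑ c : 𝒪[F] ⧸ Ideal.span {π ^ n}, haarProb 𝒪[F] (A ∩ {o | π ^ n ∣ Y o - c.out}) =
      haarProb 𝒪[F] A := by
  have hpre : ∀ c : 𝒪[F] ⧸ Ideal.span {π ^ n}, {o : 𝒪[F] | π ^ n ∣ Y o - c.out} =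
      (fun o => Ideal.Quotient.mk (Ideal.span {π ^ n}) (Y o)) ⁻¹' {c} := fun c =>
    congrArg (Y ⁻¹' ·) (setOf_pow_dvd_sub_out n c)
  have h1 := sum_measure_preimage_singleton (μ := (haarProb 𝒪[F]).restrict A)
    (f := fun o => Ideal.Quotient.mk (Ideal.span {π ^ n}) (Y o)) Finset.univ (fun c _ => by
      rw [← hpre]
      exact hY _)
  rw [Finset.coe_univ, Set.preimage_univ, Measure.restrict_apply_univ] at h1
  rw [← h1]
  refine Finset.sum_congr rfl fun c _ => ?_
  rw [← hpre, Measure.restrict_apply (hY _), Set.inter_comm]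

theorem sum_haarProb_inter_coset (hπ : Irreducible π) (n : ℕ)
    [Fintype (𝒪[F] ⧸ Ideal.span {π ^ n})] (A : Set 𝒪[F]) :
    ∑ c : 𝒪[F] ⧸ Ideal.span {π ^ n}, haarProb 𝒪[F] (A ∩ {o | π ^ n ∣ o - c.out}) =
      haarProb 𝒪[F] A :=
  sum_haarProb_inter_preimage_coset n (Y := id) (measurableSet_setOf_pow_dvd_sub hπ n) A

theorem card_quotient_mul_haarProb (hπ : Irreducible π) (n : ℕ) :
    (Nat.card (𝒪[F] ⧸ Ideal.span {π ^ n}) : ℝ≥0∞) * haarProb 𝒪[F] {o | π ^ n ∣ o} = 1 := by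
  have := finite_quotient_span_pow hπ n
  have := Fintype.ofFinite (𝒪[F] ⧸ Ideal.span {π ^ n})
  have h := sum_haarProb_inter_coset hπ n (Set.univ)
  simp only [Set.univ_inter, haarProb_coset, Finset.sum_const, nsmul_eq_mul, measure_univ] at h
  rwa [Nat.card_eq_fintype_card]

end Cosets

/-! ### Expanding maps of the valuation ring -/

section Expanding

variable {F : Type*} [Field F] [ValuativeRel F] {π : 𝒪[F]}

variable (π) in
/-- The map `Y` of `𝒪` to itself multiplies all distances that are at most `|π ^ K|`
by `|π ^ K|⁻¹`. -/
def IsExpanding (K : ℕ) (Y : 𝒪[F] → 𝒪[F]) : Prop :=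
  ∀ o o' s : 𝒪[F], o - o' = π ^ K * s → ∃ u : 𝒪[F]ˣ, Y o - Y o' = u * s

theorem IsExpanding.pow_dvd_sub {K : ℕ} {Y : 𝒪[F] → 𝒪[F]} (hY : IsExpanding π K Y) {L : ℕ}
    {o o' : 𝒪[F]} (h : π ^ (K + L) ∣ o - o') : π ^ L ∣ Y o - Y o' := by
  obtain ⟨s, hs⟩ := h
  obtain ⟨u, hu⟩ := hY o o' (π ^ L * s) (by rw [hs, pow_add, mul_assoc])
  rw [hu]
  exact (dvd_mul_right _ _).mul_left _

variable [TopologicalSpace F] [IsNonarchimedeanLocalField F]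

/-- On a coset of `π ^ K 𝒪`, the map `Y` induces a bijection between the cosets
of `π ^ (K + L) 𝒪` in it and all cosets of `π ^ L 𝒪`. -/
theorem IsExpanding.exists_setOf_eq (hπ : Irreducible π) {K : ℕ} {Y : 𝒪[F] → 𝒪[F]}
    (hY : IsExpanding π K Y) (L : ℕ) (a c : 𝒪[F]) :
    ∃ b, {o | π ^ L ∣ Y o - c} ∩ {o | π ^ K ∣ o - a} = {o | π ^ (K + L) ∣ o - b} := by
  let G : 𝒪[F] → 𝒪[F] := fun s => Y (a + π ^ K * s)
  have hG : ∀ s s', π ^ L ∣ G s - G s' ↔ π ^ L ∣ s - s' := by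
    intro s s'
    obtain ⟨u, hu⟩ := hY (a + π ^ K * s) (a + π ^ K * s') (s - s') (by ring)
    show π ^ L ∣ Y _ - Y _ ↔ _
    rw [hu, Units.dvd_mul_left]
  -- By finiteness of `𝒪 / π ^ L`, the injection induced by `G` on it is surjective.
  have := finite_quotient_span_pow hπ L
  have hmk : ∀ x y : 𝒪[F], Ideal.Quotient.mk (Ideal.span {π ^ L}) x =
      Ideal.Quotient.mk (Ideal.span {π ^ L}) y ↔ π ^ L ∣ x - y := fun x y => by
    rw [Ideal.Quotient.mk_eq_mk_iff_sub_mem, Ideal.mem_span_singleton]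
  let H : 𝒪[F] ⧸ Ideal.span {π ^ L} → 𝒪[F] ⧸ Ideal.span {π ^ L} :=
    fun t => Ideal.Quotient.mk _ (G t.out)
  have hH : Function.Injective H := fun t t' h => by
    have h1 := (hmk _ _).2 ((hG _ _).1 ((hmk _ _).1 h))
    have hout : ∀ t : 𝒪[F] ⧸ Ideal.span {π ^ L}, Ideal.Quotient.mk _ t.out = t :=
      Ideal.Quotient.mk_out
    rwa [hout, hout] at h1
  obtain ⟨t, ht⟩ := Finite.surjective_of_injective hH (Ideal.Quotient.mk _ c)
  have ht' : π ^ L ∣ G t.out - c := (hmk _ _).1 ht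
  refine ⟨a + π ^ K * t.out, ?_⟩
  ext o
  simp only [Set.mem_inter_iff, Set.mem_ofPred_eq]
  constructor
  · rintro ⟨h1, s, hs⟩
    obtain rfl : o = a + π ^ K * s := by rw [← hs]; ring
    have h2 : π ^ L ∣ G s - G t.out := by
      have := dvd_sub h1 ht'
      rwa [sub_sub_sub_cancel_right] at this
    have h3 := mul_dvd_mul_left (π ^ K) ((hG _ _).1 h2)
    rw [pow_add]
    convert h3 using 1
    ring
  · intro h
    constructor
    · have := dvd_add (hY.pow_dvd_sub h) ht'
      simpa [G] using this
    · have h1 : π ^ K ∣ o - (a + π ^ K * t.out) := (pow_dvd_pow π (Nat.le_add_right K L)).trans h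
      have h2 := dvd_add h1 (dvd_mul_right (π ^ K) t.out)
      convert h2 using 1
      ring

variable [MeasurableSpace F] [BorelSpace F]

theorem IsExpanding.measurableSet (hπ : Irreducible π) {K : ℕ} {Y : 𝒪[F] → 𝒪[F]}
    (hY : IsExpanding π K Y) (L : ℕ) (c : 𝒪[F]) : MeasurableSet {o | π ^ L ∣ Y o - c} := by
  refine IsOpen.measurableSet (isOpen_iff_mem_nhds.2 fun o ho => ?_)
  filter_upwards [(isOpen_setOf_pow_dvd_sub hπ (K + L) o).mem_nhds (by simp)] with o' ho'
  have := dvd_add (hY.pow_dvd_sub ho') ho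
  simpa using this

/-- If `Y` expands by `π ^ K`, then its value is uniformly distributed and independent of all
events that are determined by the residue class modulo `π ^ K`. -/
theorem IsExpanding.haarProb_inter (hπ : Irreducible π) {K : ℕ} {Y : 𝒪[F] → 𝒪[F]}
    (hY : IsExpanding π K Y) (L : ℕ) (c : 𝒪[F]) (A : Set 𝒪[F])
    (hA : ∀ o o', π ^ K ∣ o - o' → (o ∈ A ↔ o' ∈ A)) :
    haarProb 𝒪[F] (A ∩ {o | π ^ L ∣ Y o - c}) =
      haarProb 𝒪[F] A * haarProb 𝒪[F] {o | π ^ L ∣ o} := by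
  classical
  have := finite_quotient_span_pow hπ K
  have := Fintype.ofFinite (𝒪[F] ⧸ Ideal.span {π ^ K})
  have := finite_quotient_span_pow hπ L
  have := Fintype.ofFinite (𝒪[F] ⧸ Ideal.span {π ^ L})
  let τ : ℝ≥0∞ := ∑ a : 𝒪[F] ⧸ Ideal.span {π ^ K},
    if a.out ∈ A then haarProb 𝒪[F] {o | π ^ (K + L) ∣ o} else 0
  -- The measure on the left does not depend on the class `c`.
  have h1 : ∀ c, haarProb 𝒪[F] (A ∩ {o | π ^ L ∣ Y o - c}) = τ := by
    intro c
    rw [← sum_haarProb_inter_coset hπ K]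
    refine Finset.sum_congr rfl fun a _ => ?_
    split_ifs with ha
    · obtain ⟨b, hb⟩ := hY.exists_setOf_eq hπ L a.out c
      have : A ∩ {o | π ^ L ∣ Y o - c} ∩ {o | π ^ K ∣ o - a.out} =
          {o | π ^ (K + L) ∣ o - b} := by
        rw [← hb, Set.inter_assoc]
        exact Set.inter_eq_right.2 fun o ho => (hA o _ ho.2).2 ha
      rw [this, haarProb_coset]
    · have : A ∩ {o | π ^ L ∣ Y o - c} ∩ {o | π ^ K ∣ o - a.out} = ∅ := by
        ext o
        simp only [Set.mem_inter_iff, Set.mem_ofPred_eq, Set.mem_empty_iff_false, iff_false]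
        exact fun ho => ha ((hA o _ ho.2).1 ho.1.1)
      rw [this, measure_empty]
  have h2 : (Nat.card (𝒪[F] ⧸ Ideal.span {π ^ L}) : ℝ≥0∞) * τ = haarProb 𝒪[F] A := by
    have hpart := sum_haarProb_inter_preimage_coset L (hY.measurableSet hπ L) A
    simp only [h1, Finset.sum_const, nsmul_eq_mul] at hpart
    rwa [Nat.card_eq_fintype_card]
  rw [h1, ← h2, mul_comm _ τ, mul_assoc, card_quotient_mul_haarProb hπ, mul_one]

/-- The residue classes modulo `π ^ L` of the values of increasingly expanding maps are pairwise
independent and obey the strong law of large numbers. -/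
theorem ae_tendsto_average_of_isExpanding (hπ : Irreducible π) {L : ℕ} {Y : ℕ → 𝒪[F] → 𝒪[F]}
    {K : ℕ → ℕ} (hY : ∀ i, IsExpanding π (K i) (Y i)) (hK : ∀ i j, i < j → K i + L ≤ K j)
    (c : 𝒪[F]) :
    ∀ᵐ o ∂haarProb 𝒪[F], Tendsto (fun N : ℕ => (N : ℝ)⁻¹ *
      ∑ i ∈ Finset.range N, {y : 𝒪[F] | π ^ L ∣ y - c}.indicator (1 : 𝒪[F] → ℝ) (Y i o)) atTop
        (𝓝 (haarProb 𝒪[F] {y | π ^ L ∣ y - c}).toReal) := by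
  have hm : ∀ i, haarProb 𝒪[F] {o | π ^ L ∣ Y i o - c} = haarProb 𝒪[F] {y | π ^ L ∣ y - c} := by
    intro i
    have := (hY i).haarProb_inter hπ L c Set.univ fun _ _ _ => Iff.rfl
    rwa [Set.univ_inter, measure_univ, one_mul, ← haarProb_coset L c] at this
  refine ae_tendsto_average_indicator (haarProb 𝒪[F]) (fun i => {o | π ^ L ∣ Y i o - c})
    (fun i => (hY i).measurableSet hπ L c) hm fun i j hij => ?_
  rw [hm j, haarProb_coset]
  refine (hY j).haarProb_inter hπ L c _ fun o o' h => ?_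
  have h1 := (hY i).pow_dvd_sub ((pow_dvd_pow π (hK i j hij)).trans h)
  simp only [Set.mem_ofPred_eq]
  constructor <;> intro h2
  · have := dvd_sub h2 h1
    rwa [sub_sub_sub_cancel_left] at this
  · have := dvd_add h1 h2
    rwa [sub_add_sub_cancel] at this

end Expanding

/-! ### Powers prime to the characteristic are expanding -/

section Powers

variable {F : Type*} [Field F] [ValuativeRel F] [TopologicalSpace F] [IsNonarchimedeanLocalField F]
variable (p : ℕ) [Fact p.Prime] [CharP F p] {π : 𝒪[F]}

/-- On the ball `x (1 + π 𝒪)`, raising to a power `m` prime to `p` multiplies all distances by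
`|x| ^ (m - 1)`, because the derivative `m x ^ (m - 1)` has constant absolute value there. In the
coordinate `o` on the ball, the factor is `|x| ^ m |π| = |π| ^ (1 - d m)`. -/
theorem isExpanding_intPart_pow (hπ : Irreducible π) {x : F} {d : ℕ} (hd : 1 ≤ d) {u : 𝒪[F]ˣ}
    (hx : x * (π : F) ^ d = (u : 𝒪[F])) {m : ℕ} (hm : ¬ p ∣ m) :
    IsExpanding π (d * m - 1)
      (fun o : 𝒪[F] => intPart p π ((x * (1 + π * o : 𝒪[F])) ^ m)) := by
  intro o o' s hs
  have := charP_residueField F p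
  have hm0 : m ≠ 0 := by
    rintro rfl
    exact hm (dvd_zero p)
  let a : 𝒪[F] := 1 + π * o
  let b : 𝒪[F] := 1 + π * o'
  let W : 𝒪[F] := ∑ i ∈ Finset.range m, a ^ i * b ^ (m - 1 - i)
  have hres : ∀ o : 𝒪[F], IsLocalRing.residue 𝒪[F] (1 + π * o) = 1 := by
    intro o
    have : IsLocalRing.residue 𝒪[F] π = 0 := by
      rw [IsLocalRing.residue_eq_zero_iff]
      exact hπ.not_isUnit
    rw [map_add, map_mul, this, zero_mul, add_zero, map_one]
  have hW : IsUnit W := by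
    rw [← IsLocalRing.residue_ne_zero_iff_isUnit]
    simp only [W, a, b, map_sum, map_mul, map_pow, hres, one_pow, mul_one, Finset.sum_const,
      Finset.card_range, nsmul_eq_mul]
    rwa [Ne, CharP.cast_eq_zero_iff 𝓀[F] p]
  obtain ⟨w, hw⟩ := hW
  have hab : a ^ m - b ^ m = W * (π * π ^ (d * m - 1) * s) := by
    rw [← geom_sum₂_mul a b m]
    congr 1
    show 1 + π * o - (1 + π * o') = _
    rw [mul_assoc, ← hs]
    ring
  have hdm : 1 ≤ d * m := Nat.mul_pos hd (Nat.pos_of_ne_zero hm0)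
  rw [← pow_succ', Nat.sub_add_cancel hdm] at hab
  have hab' := congrArg (Subtype.val : 𝒪[F] → F) hab
  push_cast at hab'
  have key : (x * a) ^ m = (x * b) ^ m + ((u ^ m * w : 𝒪[F]ˣ) * s : 𝒪[F]) := by
    push_cast
    rw [← hx, hw, mul_pow x (a : F), mul_pow x (b : F), mul_pow x, ← pow_mul]
    linear_combination x ^ m * hab'
  refine ⟨u ^ m * w, ?_⟩
  show intPart p π ((x * a) ^ m) - intPart p π ((x * b) ^ m) = _
  rw [key, intPart_add_coe hπ, add_sub_cancel_left]

end Powers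

/-! ### Means of real sequences -/

section Averages

/-- The Cesàro means of the real sequence `g` converge to `c`. -/
def HasMean (g : ℕ → ℝ) (c : ℝ) : Prop :=
  Tendsto (fun N : ℕ => (N : ℝ)⁻¹ * ∑ n ∈ Finset.range N, g n) atTop (𝓝 c)

theorem hasMean_const (c : ℝ) : HasMean (fun _ => c) c := by
  refine tendsto_const_nhds.congr' ?_
  filter_upwards [eventually_gt_atTop 0] with N hN
  have : (N : ℝ) ≠ 0 := by positivity
  simp [this]

theorem HasMean.const_mul {g : ℕ → ℝ} {c : ℝ} (h : HasMean g c) (a : ℝ) :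
    HasMean (fun n => a * g n) (a * c) := by
  refine (Tendsto.const_mul a h).congr fun N => ?_
  rw [← Finset.mul_sum]
  ring

theorem HasMean.sum {ι : Type*} (s : Finset ι) {g : ι → ℕ → ℝ} {c : ι → ℝ}
    (h : ∀ i ∈ s, HasMean (g i) (c i)) : HasMean (fun n => ∑ i ∈ s, g i n) (∑ i ∈ s, c i) := by
  refine (tendsto_finsetSum s h).congr fun N => ?_
  rw [← Finset.mul_sum, Finset.sum_comm]

theorem HasMean.le {g g' : ℕ → ℝ} {c c' : ℝ} (h : HasMean g c) (h' : HasMean g' c')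
    (hle : ∀ n, g n ≤ g' n) : c ≤ c' :=
  le_of_tendsto_of_tendsto' h h' fun N => by
    gcongr
    exact hle _

theorem HasMean.comp_succ {g : ℕ → ℝ} {c : ℝ} (h : HasMean g c) :
    HasMean (fun n => g (n + 1)) c := by
  have h1 : Tendsto (fun N : ℕ => 1 + (N : ℝ)⁻¹) atTop (𝓝 (1 + 0)) :=
    tendsto_const_nhds.add tendsto_inv_atTop_nhds_zero_nat
  have h2 := (h1.mul (h.comp (tendsto_add_atTop_nat 1))).sub
    ((tendsto_inv_atTop_nhds_zero_nat (𝕜 := ℝ)).mul_const (g 0))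
  rw [add_zero, one_mul, zero_mul, sub_zero] at h2
  refine h2.congr' ?_
  filter_upwards [eventually_gt_atTop 0] with N hN
  have : (N : ℝ) ≠ 0 := by positivity
  have : (N : ℝ) + 1 ≠ 0 := by positivity
  simp only [Function.comp_apply, Finset.sum_range_succ' g N]
  push_cast
  field_simp
  ring

/-- Means pass to the limit under approximation up to an error of small mean. -/
theorem hasMean_of_approx {g : ℕ → ℝ} {c : ℝ}
    (H : ∀ ε > 0, ∃ (g' h : ℕ → ℝ) (c' d : ℝ), HasMean g' c' ∧ HasMean h d ∧
      (∀ n, |g n - g' n| ≤ h n) ∧ d ≤ ε ∧ |c - c'| ≤ ε) : HasMean g c := by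
  refine Metric.tendsto_atTop.2 fun ε hε => ?_
  obtain ⟨g', h, c', d, hg', hh, hle, hd, hc⟩ := H (ε / 4) (by positivity)
  obtain ⟨N₁, h₁⟩ := Metric.tendsto_atTop.1 hg' (ε / 4) (by positivity)
  obtain ⟨N₂, h₂⟩ := Metric.tendsto_atTop.1 hh (ε / 4) (by positivity)
  refine ⟨max N₁ N₂, fun N hN => ?_⟩
  have e1 := h₁ N (le_trans (le_max_left _ _) hN)
  have e2 := h₂ N (le_trans (le_max_right _ _) hN)
  rw [Real.dist_eq] at e1 e2 ⊢
  have e3 : |(N : ℝ)⁻¹ * ∑ n ∈ Finset.range N, g n - (N : ℝ)⁻¹ * ∑ n ∈ Finset.range N, g' n| ≤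
      (N : ℝ)⁻¹ * ∑ n ∈ Finset.range N, h n := by
    rw [← mul_sub, ← Finset.sum_sub_distrib, abs_mul, abs_of_nonneg (by positivity)]
    gcongr
    exact (Finset.abs_sum_le_sum_abs _ _).trans (Finset.sum_le_sum fun n _ => hle n)
  rw [abs_lt] at *
  rw [abs_le] at *
  constructor <;> linarith [e1.1, e1.2, e2.1, e2.2, e3.1, e3.2, hc.1, hc.2]

theorem sum_range_ite_mod {A : Type*} [AddCommMonoid A] {M r : ℕ} (hr : r < M) (g : ℕ → A)
    (N : ℕ) :
    ∑ n ∈ Finset.range N, (if n % M = r then g (n / M) else 0) =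
      ∑ i ∈ Finset.range ((N + (M - 1 - r)) / M), g i := by
  have hM : 0 < M := by omega
  induction N with
  | zero => simp [Nat.div_eq_of_lt (show M - 1 - r < M by omega)]
  | succ N ih =>
    rw [Finset.sum_range_succ, ih]
    have h0 := Nat.div_add_mod N M
    have hlt := Nat.mod_lt N hM
    split_ifs with h
    · have e1 : (N + (M - 1 - r)) / M = N / M := by
        rw [Nat.div_eq_iff hM]
        have : N / M * M = M * (N / M) := Nat.mul_comm _ _
        omega
      have e2 : (N + 1 + (M - 1 - r)) / M = N / M + 1 := by
        rw [Nat.div_eq_iff hM]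
        have : (N / M + 1) * M = M * (N / M) + M := by ring
        omega
      rw [e1, e2, Finset.sum_range_succ]
    · have e1 : (N + 1 + (M - 1 - r)) / M = (N + (M - 1 - r)) / M := by
        rw [Nat.succ_add, Nat.succ_div_of_not_dvd]
        rintro ⟨t, ht⟩
        rcases lt_or_ge (N % M) r with hlt' | hge
        · have : N + (M - 1 - r) + 1 = M * (N / M) + (N % M + M - r) := by omega
          have hmod : (N + (M - 1 - r) + 1) % M = N % M + M - r := by
            rw [this, Nat.mul_add_mod, Nat.mod_eq_of_lt (by omega)]
          rw [ht, Nat.mul_mod_right] at hmod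
          omega
        · have : N + (M - 1 - r) + 1 = M * (N / M + 1) + (N % M - r) := by
            rw [Nat.mul_add]
            omega
          have hmod : (N + (M - 1 - r) + 1) % M = N % M - r := by
            rw [this, Nat.mul_add_mod, Nat.mod_eq_of_lt (by omega)]
          rw [ht, Nat.mul_mod_right] at hmod
          omega
      rw [e1, add_zero]

/-- A sequence of mean `c` spread out over a residue class modulo `M` has mean `c / M`. -/
theorem HasMean.ite_mod {M r : ℕ} (hr : r < M) {g : ℕ → ℝ} {c : ℝ} (h : HasMean g c) :
    HasMean (fun n => if n % M = r then g (n / M) else 0) (c / M) := by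
  have hM : 0 < M := by omega
  have hM' : (0 : ℝ) < M := by exact_mod_cast hM
  let q : ℕ → ℕ := fun N => (N + (M - 1 - r)) / M
  have hq : Tendsto q atTop atTop :=
    (Nat.tendsto_div_const_atTop hM.ne').comp (tendsto_add_atTop_nat _)
  have hq1 : ∀ N : ℕ, (N : ℝ) ≤ M * q N + M ∧ (M * q N : ℝ) ≤ N + M := by
    intro N
    have h1 := Nat.div_add_mod (N + (M - 1 - r)) M
    have h2 := Nat.mod_lt (N + (M - 1 - r)) hM
    constructor
    · have : N ≤ M * q N + M := by simp only [q]; omega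
      exact_mod_cast this
    · have : M * q N ≤ N + M := by simp only [q]; omega
      exact_mod_cast this
  have hqN : Tendsto (fun N : ℕ => (N : ℝ)⁻¹ * q N) atTop (𝓝 (M : ℝ)⁻¹) := by
    have l1 : Tendsto (fun N : ℕ => (M : ℝ)⁻¹ - (N : ℝ)⁻¹) atTop (𝓝 ((M : ℝ)⁻¹ - 0)) :=
      tendsto_const_nhds.sub tendsto_inv_atTop_nhds_zero_nat
    have l2 : Tendsto (fun N : ℕ => (M : ℝ)⁻¹ + (N : ℝ)⁻¹) atTop (𝓝 ((M : ℝ)⁻¹ + 0)) :=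
      tendsto_const_nhds.add tendsto_inv_atTop_nhds_zero_nat
    rw [sub_zero] at l1
    rw [add_zero] at l2
    refine tendsto_of_tendsto_of_tendsto_of_le_of_le' l1 l2 ?_ ?_ <;>
      filter_upwards [eventually_gt_atTop 0] with N hN
    all_goals
      have hN' : (0 : ℝ) < N := by exact_mod_cast hN
      have h3 := hq1 N
      have e : (M : ℝ)⁻¹ - (N : ℝ)⁻¹ = (N : ℝ)⁻¹ * ((N - M) / M) := by field_simp
      have e' : (M : ℝ)⁻¹ + (N : ℝ)⁻¹ = (N : ℝ)⁻¹ * ((N + M) / M) := by field_simp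
      first | rw [e] | rw [e']
      gcongr
    · rw [div_le_iff₀ hM']
      linarith [h3.1]
    · rw [le_div_iff₀ hM']
      linarith [h3.2]
  have := hqN.mul (h.comp hq)
  rw [mul_comm, ← div_eq_mul_inv] at this
  refine this.congr fun N => ?_
  rw [sum_range_ite_mod hr]
  simp only [Function.comp_apply]
  rcases Nat.eq_zero_or_pos (q N) with h0 | h0
  · rw [show (N + (M - 1 - r)) / M = 0 from h0, h0]
    simp
  · have : (q N : ℝ) ≠ 0 := by positivity
    show _ = (N : ℝ)⁻¹ * ∑ i ∈ Finset.range (q N), g i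
    field_simp

theorem hasMean_of_residue_classes {M : ℕ} {g : ℕ → ℝ} {c : ℕ → ℝ} (hM : 0 < M)
    (h : ∀ r < M, HasMean (fun i => g (r + M * i)) (c r)) :
    HasMean g ((∑ r ∈ Finset.range M, c r) / M) := by
  rw [Finset.sum_div]
  have := HasMean.sum (Finset.range M) fun r hr => (h r (Finset.mem_range.1 hr)).ite_mod
    (Finset.mem_range.1 hr)
  refine this.congr fun N => ?_
  congr 1
  refine Finset.sum_congr rfl fun n _ => ?_
  dsimp only
  rw [Finset.sum_eq_single (n % M)]
  · rw [if_pos rfl, Nat.mod_add_div]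
  · intro r _ hr
    rw [if_neg (Ne.symm hr)]
  · intro hn
    exact absurd (Finset.mem_range.2 (Nat.mod_lt n hM)) hn

theorem sum_range_ite_eq_sum_nth (P : ℕ → Prop) [DecidablePred P] (g : ℕ → ℝ) (N : ℕ) :
    ∑ n ∈ Finset.range N, (if P n then g n else 0) =
      ∑ j ∈ Finset.range (Nat.count P N), g (Nat.nth P j) := by
  induction N with
  | zero => simp
  | succ N ih =>
    rw [Finset.sum_range_succ, ih, Nat.count_succ]
    split_ifs with h
    · rw [Finset.sum_range_succ, Nat.nth_count h]
    · rw [add_zero, add_zero]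

/-- Means along the increasing enumeration of a set of positive density. -/
theorem HasMean.comp_nth {P : ℕ → Prop} [DecidablePred P] (hP : (Set.ofPred P).Infinite)
    {g : ℕ → ℝ} {δ c : ℝ} (hδ : δ ≠ 0) (h1 : HasMean (fun n => if P n then 1 else 0) δ)
    (h : HasMean (fun n => if P n then g n else 0) (δ * c)) :
    HasMean (fun j => g (Nat.nth P j)) c := by
  have ht : Tendsto (Nat.nth P) atTop atTop := (Nat.nth_strictMono hP).tendsto_atTop
  have h2 := (h.comp ht).div (h1.comp ht) hδ
  rw [mul_div_cancel_left₀ c hδ] at h2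
  refine h2.congr' ?_
  filter_upwards [ht.eventually_gt_atTop 0] with J hJ
  have hJ' : (Nat.nth P J : ℝ) ≠ 0 := by positivity
  simp only [Pi.div_apply, Function.comp_apply, sum_range_ite_eq_sum_nth,
    Nat.count_nth_of_infinite hP]
  simp only [Finset.sum_const, Finset.card_range, nsmul_eq_mul, mul_one]
  rw [mul_div_mul_left _ _ (inv_ne_zero hJ'), div_eq_inv_mul]

end Averages

/-! ### Uniform distribution along the exponents prime to `p` -/

section Cylinders

variable {F : Type*} [Field F] [ValuativeRel F] [TopologicalSpace F] [IsNonarchimedeanLocalField F]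
variable {π : 𝒪[F]}

/-- A continuous function on the compact ring `𝒪` is uniformly close to a function of finitely many
digits. -/
theorem exists_pow_dvd_sub_imp_abs_sub_le (hπ : Irreducible π) (f : C(𝒪[F], ℝ)) {ε : ℝ}
    (hε : 0 < ε) : ∃ L : ℕ, 1 ≤ L ∧ ∀ y y', π ^ L ∣ y - y' → |f y - f y'| ≤ ε := by
  have := t2Space F
  by_contra! H
  let D : ℕ → Set (𝒪[F] × 𝒪[F]) := fun L => {z | z.1 - z.2 ∈ Ideal.span {π ^ (L + 1)} ∧
    ε ≤ |f z.1 - f z.2|}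
  have hD : ∀ L, IsClosed (D L) := fun L =>
    ((IsNoetherianRing.isClosed_ideal (Ideal.span {π ^ (L + 1)})).preimage
      (f := fun z : 𝒪[F] × 𝒪[F] => z.1 - z.2) (by fun_prop)).inter
        (isClosed_le continuous_const
          ((f.continuous.comp continuous_fst).sub (f.continuous.comp continuous_snd)).abs)
  obtain ⟨⟨y, y'⟩, hy⟩ := (hD 0).isCompact.nonempty_iInter_of_sequence_nonempty_isCompact_isClosed D
    (fun L z hz => ⟨Ideal.span_singleton_le_span_singleton.2 (pow_dvd_pow π (Nat.le_succ _)) hz.1,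
      hz.2⟩)
    (fun L => by
      obtain ⟨y, y', h1, h2⟩ := H (L + 1) (Nat.succ_le_succ L.zero_le)
      exact ⟨(y, y'), Ideal.mem_span_singleton.2 h1, h2.le⟩) hD
  have hy' : ∀ L, (y, y') ∈ D L := fun L => Set.mem_iInter.1 hy L
  have h0 : HasSum (fun i : ℕ => (0 : 𝒪[F]) * π ^ i) (y - y') :=
    (hasSum_digits_iff hπ (fun _ => 0) _).2 fun N => by
      simpa using Ideal.span_singleton_le_span_singleton.2 (pow_dvd_pow π (Nat.le_succ N)) (hy' N).1
  have h1 : y - y' = 0 := h0.unique (by simp)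
  have h2 : ε ≤ |f y - f y'| := (hy' 0).2
  rw [sub_eq_zero.1 h1, sub_self, abs_zero] at h2
  exact absurd hε h2.not_gt

variable (p : ℕ) [hp : Fact p.Prime] [MeasurableSpace F] [BorelSpace F]

/-- Along the integers prime to `p`, the sequence `Y` of elements of `𝒪` is uniformly distributed
for the Haar measure. The means are taken over all integers, with the terms at multiples of `p`
replaced by zero, whence the factor `1 - 1/p`. -/
def IsUDPrimeTo (Y : ℕ → 𝒪[F]) : Prop :=
  ∀ f : C(𝒪[F], ℝ), HasMean (fun n => if p ∣ n then 0 else f (Y n))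
    ((1 - 1 / (p : ℝ)) * ∫ y, f y ∂haarProb 𝒪[F])

theorem sum_range_ite_dvd (L : ℕ) (a : ℝ) :
    ∑ r ∈ Finset.range (p * L), (if p ∣ r then 0 else a) = p * L * ((1 - 1 / (p : ℝ)) * a) := by
  have hp0 := hp.out.pos
  have hp0' : (p : ℝ) ≠ 0 := by exact_mod_cast hp0.ne'
  have h1 := sum_range_ite_mod hp0 (fun _ => a) (p * L)
  have h2 : (p * L + (p - 1 - 0)) / p = L := by
    rw [Nat.mul_add_div hp0, Nat.div_eq_of_lt (by omega), add_zero]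
  rw [h2, Finset.sum_const, Finset.card_range, nsmul_eq_mul] at h1
  have h3 : ∑ r ∈ Finset.range (p * L), (if p ∣ r then 0 else a) +
      ∑ r ∈ Finset.range (p * L), (if r % p = 0 then a else 0) = p * L * a := by
    rw [← Finset.sum_add_distrib]
    simp [← Nat.dvd_iff_mod_eq_zero, ite_add_ite]
  rw [h1] at h3
  field_simp
  linear_combination h3

theorem isUDPrimeTo_of_residue_classes (hπ : Irreducible π) {Y : ℕ → 𝒪[F]}
    (H : ∀ L, 1 ≤ L → ∀ (c : 𝒪[F] ⧸ Ideal.span {π ^ L}) (r : ℕ), ¬ p ∣ r →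
      HasMean (fun i => {y : 𝒪[F] | π ^ L ∣ y - c.out}.indicator 1 (Y (r + p * L * i)))
        (haarProb 𝒪[F] {y | π ^ L ∣ y - c.out}).toReal) : IsUDPrimeTo p Y := by
  have hp0 := hp.out.pos
  have hp1 : (1 : ℝ) < p := by exact_mod_cast hp.out.one_lt
  intro f
  have hfi : Integrable f (haarProb 𝒪[F]) := f.continuous.integrable_of_hasCompactSupport
    (HasCompactSupport.of_compactSpace f)
  refine hasMean_of_approx fun ε hε => ?_
  obtain ⟨L, hL, hf⟩ := exists_pow_dvd_sub_imp_abs_sub_le hπ f hε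
  have hpL : 0 < p * L := Nat.mul_pos hp0 hL
  have := finite_quotient_span_pow hπ L
  have := Fintype.ofFinite (𝒪[F] ⧸ Ideal.span {π ^ L})
  let B : 𝒪[F] ⧸ Ideal.span {π ^ L} → Set 𝒪[F] := fun c => {y | π ^ L ∣ y - c.out}
  let S : 𝒪[F] → ℝ := fun y => ∑ c, f c.out * (B c).indicator 1 y
  have hS : ∀ y, |f y - S y| ≤ ε := by
    intro y
    have h1 : S y = f (Ideal.Quotient.mk (Ideal.span {π ^ L}) y).out := by
      simp only [S, B, setOf_pow_dvd_sub_out]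
      rw [Finset.sum_eq_single (Ideal.Quotient.mk (Ideal.span {π ^ L}) y)]
      · simp
      · intro c _ hc
        simp [Ne.symm hc]
      · simp
    rw [h1]
    refine hf _ _ ?_
    rw [← Ideal.mem_span_singleton, ← Ideal.Quotient.mk_eq_mk_iff_sub_mem]
    exact (Ideal.Quotient.mk_out _).symm
  have hBi : ∀ c, Integrable ((B c).indicator (1 : 𝒪[F] → ℝ)) (haarProb 𝒪[F]) := fun c =>
    (integrable_const (1 : ℝ)).indicator (measurableSet_setOf_pow_dvd_sub hπ L _)
  have hSint : ∫ y, S y ∂haarProb 𝒪[F] = ∑ c, f c.out * (haarProb 𝒪[F] (B c)).toReal := by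
    rw [integral_finsetSum _ fun c _ => (hBi c).const_mul _]
    refine Finset.sum_congr rfl fun c _ => ?_
    rw [integral_const_mul, integral_indicator_one (measurableSet_setOf_pow_dvd_sub hπ L _)]
    rfl
  have hSi : Integrable S (haarProb 𝒪[F]) := integrable_finsetSum _ fun c _ => (hBi c).const_mul _
  have hmean : ∀ c, HasMean (fun n => if p ∣ n then 0 else (B c).indicator 1 (Y n))
      ((1 - 1 / (p : ℝ)) * (haarProb 𝒪[F] (B c)).toReal) := by
    intro c
    have := hasMean_of_residue_classes (M := p * L)
      (g := fun n => if p ∣ n then 0 else (B c).indicator 1 (Y n))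
      (c := fun r => if p ∣ r then 0 else (haarProb 𝒪[F] (B c)).toReal) hpL (fun r _ => by
        have hdvd : ∀ i, p ∣ r + p * L * i ↔ p ∣ r := fun i =>
          (Nat.dvd_add_left ((dvd_mul_right p L).mul_right i))
        simp only [hdvd]
        split_ifs with hr
        · exact hasMean_const 0
        · exact H L hL c r hr)
    rw [sum_range_ite_dvd] at this
    have hpL' : (p * L : ℝ) ≠ 0 := by exact_mod_cast hpL.ne'
    rwa [Nat.cast_mul, mul_div_cancel_left₀ _ hpL'] at this
  refine ⟨fun n => if p ∣ n then 0 else S (Y n), fun _ => ε,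
    (1 - 1 / (p : ℝ)) * ∫ y, S y ∂haarProb 𝒪[F], ε, ?_, hasMean_const ε, fun n => ?_, le_rfl, ?_⟩
  · rw [hSint, Finset.mul_sum]
    have := HasMean.sum Finset.univ fun c _ => (hmean c).const_mul (f c.out)
    convert this using 1
    · funext n
      split_ifs <;> simp [S]
    · exact Finset.sum_congr rfl fun c _ => by ring
  · dsimp only
    split_ifs
    · simpa using hε.le
    · exact hS _
  · rw [← mul_sub, ← integral_sub hfi hSi, abs_mul]
    have h1 : |1 - 1 / (p : ℝ)| ≤ 1 := by
      have : 0 < 1 / (p : ℝ) := by positivity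
      have : 1 / (p : ℝ) < 1 := by rw [div_lt_one (by positivity)]; exact hp1
      rw [abs_le]
      constructor <;> linarith
    have h2 : |∫ y, (f y - S y) ∂haarProb 𝒪[F]| ≤ ε := by
      have := norm_integral_le_of_norm_le_const (μ := haarProb 𝒪[F]) (f := fun y => f y - S y)
        (C := ε) (Eventually.of_forall hS)
      simpa using this
    exact (mul_le_mul h1 h2 (abs_nonneg _) zero_le_one).trans (one_mul ε).le

end Cylinders

/-! ### Almost every element of absolute value greater than one -/

section AlmostEvery

variable {F : Type*} [Field F] [ValuativeRel F] [TopologicalSpace F] [IsNonarchimedeanLocalField F]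
variable {π : 𝒪[F]} [MeasurableSpace F] [BorelSpace F]

/-- A property holds almost everywhere on `|x| > 1` if it does on each ball `x (1 + π 𝒪)`: the Haar
measure of `F` on it is a multiple of the transported Haar measure of `𝒪`, and `|x| > 1` is a
countable union of compact sets, each covered by finitely many such balls. -/
theorem ae_of_ae_haarProb (hπ : Irreducible π) (ν : Measure F) [ν.IsAddHaarMeasure]
    {Q : F → Prop}
    (hQ : ∀ x, 1 < valuation F x → ∀ᵐ o ∂haarProb 𝒪[F], Q (x * (1 + π * o : 𝒪[F]))) :
    ∀ᵐ x ∂ν, 1 < valuation F x → Q x := by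
  have := t2Space F
  have hπ0 := coe_ne_zero_of_irreducible hπ
  have hO : IsOpen (𝒪[F] : Set F) := by
    have := (valuation F).isOpen_closedBall (r := 1) one_ne_zero
    simpa only [Valuation.restrict_le_one_iff] using! this
  let bad : Set F := {x | 1 < valuation F x ∧ ¬ Q x}
  have hlocal : ∀ x, 1 < valuation F x → ∃ t ∈ 𝓝 x, MeasurableSet t ∧ ν (t ∩ bad) = 0 := by
    intro x hx
    have hx0 : x ≠ 0 := by
      rintro rfl
      simp at hx
    have hxπ : x * (π : F) ≠ 0 := mul_ne_zero hx0 hπ0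
    let φ : 𝒪[F] →+ F := (AddMonoidHom.mulLeft (x * (π : F))).comp 𝒪[F].subtype.toAddMonoidHom
    have hφ : Topology.IsOpenEmbedding φ :=
      (Homeomorph.mulLeft₀ _ hxπ).isOpenEmbedding.comp hO.isOpenEmbedding_subtypeVal
    have hHaar : (ν.comap φ).IsAddHaarMeasure :=
      Measure.IsAddHaarMeasure.comap (mH := inferInstance) ν hφ
    have h1 : ν.comap φ {o | ¬ Q (x * (1 + π * o : 𝒪[F]))} = 0 := by
      rw [Measure.isAddInvariant_eq_smul_of_compactSpace (ν.comap φ) (haarProb 𝒪[F]),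
        Measure.smul_apply, ae_iff.1 (hQ x hx), smul_zero]
    rw [hφ.measurableEmbedding.comap_apply] at h1
    have hcont : Continuous fun y : F => -x + y := by fun_prop
    refine ⟨(fun y => -x + y) ⁻¹' Set.range φ, ?_, ?_, ?_⟩
    · refine (hφ.isOpen_range.preimage hcont).mem_nhds ⟨0, ?_⟩
      simp
    · exact (hφ.isOpen_range.preimage hcont).measurableSet
    · rw [← measure_preimage_add ν (-x)] at h1
      refine measure_mono_null ?_ h1
      rintro y ⟨⟨o, ho⟩, -, hy⟩
      refine ⟨o, ?_, ho⟩
      have h2 : y = x * (1 + π * o : 𝒪[F]) := by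
        have h3 : x * (π : F) * (o : F) = -x + y := ho
        push_cast
        linear_combination -h3
      show ¬ Q _
      rwa [← h2]
  have hball : ∀ n : ℕ, (ν.restrict bad)
      ({x | valuation F x ≤ valuation F ((π : F) ^ n)⁻¹} ∩ (𝒪[F] : Set F)ᶜ) = 0 := by
    intro n
    refine ((IsNonarchimedeanLocalField.isCompact_closedBall F _).inter_right
      hO.isClosed_compl).measure_zero_of_nhdsWithin ?_
    rintro x ⟨-, hx⟩
    obtain ⟨t, ht, htm, ht0⟩ := hlocal x (not_le.1 hx)
    exact ⟨t, mem_nhdsWithin_of_mem_nhds ht, by rw [Measure.restrict_apply htm, ht0]⟩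
  have hcover : (𝒪[F] : Set F)ᶜ ⊆ ⋃ n : ℕ,
      {x | valuation F x ≤ valuation F ((π : F) ^ n)⁻¹} ∩ (𝒪[F] : Set F)ᶜ := by
    intro x hx
    obtain ⟨a, n, rfl⟩ := exists_eq_coe_div_pow hπ x
    refine Set.mem_iUnion.2 ⟨n, ?_, hx⟩
    rw [Set.mem_ofPred_eq]
    rw [div_eq_mul_inv, map_mul]
    exact mul_le_of_le_one_left' a.2
  have h0 := measure_mono_null hcover (measure_iUnion_null hball)
  rw [Measure.restrict_apply hO.measurableSet.compl] at h0
  rw [ae_iff]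
  refine measure_mono_null ?_ h0
  intro x hx
  have hx' : 1 < valuation F x ∧ ¬ Q x := Classical.not_imp.1 hx
  exact ⟨not_le.2 hx'.1, hx'⟩

/-- On the ball `x (1 + π 𝒪)`, the digits of the powers with exponents `r + p L i` satisfy the strong
law of large numbers; countably many choices of cylinder set and residue class `r` suffice. -/
theorem ae_isUDPrimeTo (p : ℕ) [Fact p.Prime] [CharP F p] (hπ : Irreducible π) (ν : Measure F)
    [ν.IsAddHaarMeasure] :
    ∀ᵐ x ∂ν, 1 < valuation F x → IsUDPrimeTo p fun n => intPart p π (x ^ n) := by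
  refine ae_of_ae_haarProb hπ ν fun x hx => ?_
  obtain ⟨d, u, hd, hxd⟩ := exists_unit_mul_pow_eq_one hπ hx
  have key : ∀ L, 1 ≤ L → ∀ (c : 𝒪[F] ⧸ Ideal.span {π ^ L}) (r : ℕ), ¬ p ∣ r →
      ∀ᵐ o ∂haarProb 𝒪[F], HasMean (fun i => {y : 𝒪[F] | π ^ L ∣ y - c.out}.indicator 1
        (intPart p π ((x * (1 + π * o : 𝒪[F])) ^ (r + p * L * i))))
          (haarProb 𝒪[F] {y | π ^ L ∣ y - c.out}).toReal := by
    intro L hL c r hr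
    have hr' : ∀ i, ¬ p ∣ r + p * L * i := fun i h =>
      hr ((Nat.dvd_add_left ((dvd_mul_right p L).mul_right i)).1 h)
    refine ae_tendsto_average_of_isExpanding hπ
      (fun i => isExpanding_intPart_pow p hπ hd hxd (hr' i)) (fun i j hij => ?_) c.out
    -- Consecutive exponents in the residue class differ by `p L ≥ L`.
    have h1 : r + p * L * i + L ≤ r + p * L * j := by
      have h2 : p * L * (i + 1) ≤ p * L * j := Nat.mul_le_mul_left _ hij
      have h3 : L ≤ p * L := Nat.le_mul_of_pos_left L (Fact.out : p.Prime).pos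
      rw [Nat.mul_succ] at h2
      omega
    have h4 := Nat.mul_le_mul_left d h1
    rw [Nat.mul_add d _ L] at h4
    have h5 : L ≤ d * L := Nat.le_mul_of_pos_left L hd
    have h6 : 0 < r + p * L * i := by
      rcases Nat.eq_zero_or_pos (r + p * L * i) with h | h
      · exact absurd (h ▸ dvd_zero p) (hr' i)
      · exact h
    have h7 := Nat.mul_pos hd h6
    omega
  have hfin : ∀ L, Countable (𝒪[F] ⧸ Ideal.span {π ^ L}) := fun L => by
    have := finite_quotient_span_pow hπ L
    infer_instance
  have hall : ∀ᵐ o ∂haarProb 𝒪[F], ∀ L, 1 ≤ L → ∀ (c : 𝒪[F] ⧸ Ideal.span {π ^ L}) (r : ℕ),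
      ¬ p ∣ r → HasMean (fun i => {y : 𝒪[F] | π ^ L ∣ y - c.out}.indicator 1
        (intPart p π ((x * (1 + π * o : 𝒪[F])) ^ (r + p * L * i))))
          (haarProb 𝒪[F] {y | π ^ L ∣ y - c.out}).toReal := by
    simp only [ae_all_iff]
    exact key
  filter_upwards [hall] with o ho
  exact isUDPrimeTo_of_residue_classes p hπ ho

end AlmostEvery

/-! ### Means over all exponents -/

section Consequences

variable {F : Type*} [Field F] [ValuativeRel F] [TopologicalSpace F] [IsNonarchimedeanLocalField F]
variable (p : ℕ) [hp : Fact p.Prime] {π : 𝒪[F]}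

theorem intPart_pow_of_dvd [CharP F p] (hπ : Irreducible π) (x : F) {k n : ℕ} (h : p ^ k ∣ n) :
    intPart p π (x ^ n) = intPart p π (x ^ (n / p ^ k)) ^ p ^ k := by
  rw [← intPart_pow_char_pow hπ, ← pow_mul, Nat.div_mul_cancel h]

theorem infinite_setOf_exactly_dvd (k : ℕ) :
    (Set.ofPred fun n => p ^ k ∣ n ∧ ¬ p ^ (k + 1) ∣ n).Infinite := by
  have hk : 0 < p ^ k := pow_pos hp.out.pos k
  refine Set.infinite_of_injective_forall_mem (f := fun i : ℕ => p ^ k * (1 + p * i)) ?_ fun i => ?_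
  · intro i j hij
    have h1 := Nat.eq_of_mul_eq_mul_left hk hij
    exact Nat.eq_of_mul_eq_mul_left hp.out.pos (Nat.add_left_cancel h1)
  · refine ⟨dvd_mul_right _ _, fun h => hp.out.one_lt.ne' ?_⟩
    rw [pow_succ, Nat.mul_dvd_mul_iff_left hk] at h
    exact Nat.dvd_one.1 ((Nat.dvd_add_left (dvd_mul_right p i)).1 h)

theorem lt_card_quotient_span_sq [CharP F p] (hπ : Irreducible π) :
    p < Nat.card (𝒪[F] ⧸ Ideal.span {π ^ 2}) ∧
      Nat.card (𝒪[F] ⧸ Ideal.span {π ^ 4}) = Nat.card (𝒪[F] ⧸ Ideal.span {π ^ 2}) ^ 2 := by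
  have hprime : (Ideal.span {π} : Ideal 𝒪[F]).IsPrime :=
    (Ideal.span_singleton_prime hπ.ne_zero).2 hπ.prime
  have hne : (Ideal.span {π} : Ideal 𝒪[F]) ≠ ⊥ := by
    rw [Ne, Ideal.span_singleton_eq_bot]
    exact hπ.ne_zero
  have hcard : ∀ n, Nat.card (𝒪[F] ⧸ Ideal.span {π ^ n}) = Nat.card 𝓀[F] ^ n := by
    intro n
    have h := cardQuot_pow_of_prime (P := (Ideal.span {π} : Ideal 𝒪[F])) hne (i := n)
    rw [Ideal.span_singleton_pow, Submodule.cardQuot_apply, Submodule.cardQuot_apply,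
      ← hπ.maximalIdeal_eq] at h
    exact h
  obtain ⟨n, hn⟩ := exists_card_eq F p
  have hq : 1 < Nat.card 𝓀[F] := Finite.one_lt_card
  have hn0 : n ≠ 0 := by
    rintro rfl
    simp [hn] at hq
  have hpq : p ≤ Nat.card 𝓀[F] := by
    rw [hn]
    exact Nat.le_self_pow hn0 p
  rw [hcard, hcard]
  refine ⟨?_, by ring⟩
  nlinarith

variable [MeasurableSpace F] [BorelSpace F]

theorem IsUDPrimeTo.hasMean_exactly_dvd {Y : ℕ → 𝒪[F]} (hY : IsUDPrimeTo p Y) (k : ℕ)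
    (f : C(𝒪[F], ℝ)) :
    HasMean (fun n => if p ^ k ∣ n ∧ ¬ p ^ (k + 1) ∣ n then f (Y (n / p ^ k)) else 0)
      ((1 - 1 / (p : ℝ)) / p ^ k * ∫ y, f y ∂haarProb 𝒪[F]) := by
  have h := (hY f).ite_mod (pow_pos hp.out.pos k)
  convert h using 1
  · funext n
    simp only [← Nat.dvd_iff_mod_eq_zero]
    by_cases h1 : p ^ k ∣ n
    · have h2 : p ∣ n / p ^ k ↔ p ^ (k + 1) ∣ n := by
        rw [Nat.dvd_div_iff_mul_dvd h1, pow_succ]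
      simp only [h1, true_and, if_true, h2, ite_not]
    · simp [h1]
  · push_cast
    ring

/-- The subsequence along the exponents exactly divisible by `p ^ k` is the image under the `k`-fold
Frobenius endomorphism of the sequence along the exponents prime to `p`. -/
theorem exists_isUD_haarSupp [CharP F p] (hπ : Irreducible π) {x : F}
    (hY : IsUDPrimeTo p fun n => intPart p π (x ^ n)) (k : ℕ) :
    ∃ y : ℕ → supp p π k,
      (∀ j, (y j : 𝒪[F]) = intPart p π
        (x ^ Nat.nth (fun n => p ^ k ∣ n ∧ ¬ p ^ (k + 1) ∣ n) j)) ∧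
      IsUD (haarSupp p hπ k) y := by
  let P : ℕ → Prop := fun n => p ^ k ∣ n ∧ ¬ p ^ (k + 1) ∣ n
  have hP : (Set.ofPred P).Infinite := infinite_setOf_exactly_dvd p k
  have hp0 : (0 : ℝ) < p := by exact_mod_cast hp.out.pos
  have hp1 : (1 : ℝ) < p := by exact_mod_cast hp.out.one_lt
  refine ⟨fun j => frobeniusToSupp p hπ k (intPart p π (x ^ (Nat.nth P j / p ^ k))), fun j => ?_,
    fun f => ?_⟩
  · rw [coe_frobeniusToSupp]
    exact (intPart_pow_of_dvd p hπ x (Nat.nth_mem_of_infinite hP j).1).symm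
  · have hδ : (1 - 1 / (p : ℝ)) / p ^ k ≠ 0 := by
      have : 1 / (p : ℝ) < 1 := by rwa [div_lt_one hp0]
      have : 0 < 1 - 1 / (p : ℝ) := by linarith
      positivity
    have h1 := hY.hasMean_exactly_dvd p k (ContinuousMap.const _ 1)
    simp only [ContinuousMap.const_apply, integral_const, probReal_univ, smul_eq_mul, mul_one]
      at h1
    rw [integral_haarSupp]
    exact HasMean.comp_nth hP (g := fun n => f (frobeniusToSupp p hπ k
      (intPart p π (x ^ (n / p ^ k))))) hδ h1
      (hY.hasMean_exactly_dvd p k (f.comp ⟨_, continuous_frobeniusToSupp p hπ k⟩))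

/-- The integral over `μ_k` is transported to `𝒪` by Frobenius, so that the term `μ` of `μ*` is the
case `k = 0` of the terms `p ^ (-k) μ_k`. -/
theorem hasSum_integral_weightedMeasure [CharP F p] (hπ : Irreducible π) (f : C(𝒪[F], ℝ)) :
    HasSum (fun k : ℕ => (1 - 1 / (p : ℝ)) / p ^ k * ∫ y, f (y ^ p ^ k) ∂haarProb 𝒪[F])
      (∫ y, f y ∂weightedMeasure p hπ) := by
  have hp0 : (0 : ℝ) < p := by exact_mod_cast hp.out.pos
  have hp1 : (1 : ℝ) < p := by exact_mod_cast hp.out.one_lt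
  have hp1' : 0 ≤ 1 - 1 / (p : ℝ) := by
    have : 1 / (p : ℝ) < 1 := by rwa [div_lt_one hp0]
    linarith
  let m : ℕ → Measure 𝒪[F] := fun k => ((p : ℝ≥0∞) ^ (k + 1))⁻¹ •
    (haarSupp p hπ (k + 1)).map (Subtype.val : supp p π (k + 1) → 𝒪[F])
  have hprob : ∀ k, IsProbabilityMeasure (haarSupp p hπ k) := fun k =>
    have := compactSpace_supp p hπ k
    isProbabilityMeasure_haarProb _
  have hmass : ∀ k, m k Set.univ = ((p : ℝ≥0∞)⁻¹) ^ (k + 1) := by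
    intro k
    simp only [m, Measure.smul_apply, smul_eq_mul]
    rw [Measure.map_apply measurable_subtype_coe MeasurableSet.univ, Set.preimage_univ,
      measure_univ, mul_one, ENNReal.inv_pow]
  have hfin : IsFiniteMeasure (Measure.sum m) := by
    refine ⟨?_⟩
    rw [Measure.sum_apply _ MeasurableSet.univ]
    simp only [hmass]
    rw [ENNReal.tsum_geometric_add_one]
    have hlt : (p : ℝ≥0∞)⁻¹ < 1 := ENNReal.inv_lt_one.2 (by exact_mod_cast hp.out.one_lt)
    refine ENNReal.mul_lt_top (hlt.trans ENNReal.one_lt_top) ?_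
    exact ENNReal.inv_lt_top.2 (tsub_pos_of_lt hlt)
  have hint : ∀ (μ : Measure 𝒪[F]) [IsFiniteMeasure μ], Integrable f μ := fun μ _ =>
    f.continuous.integrable_of_hasCompactSupport (HasCompactSupport.of_compactSpace f)
  have hI : ∫ y, f y ∂weightedMeasure p hπ =
      (1 - 1 / (p : ℝ)) * (∫ y, f y ∂haarProb 𝒪[F] + ∫ y, f y ∂Measure.sum m) := by
    rw [weightedMeasure, integral_smul_measure, integral_add_measure (hint _) (hint _),
      ENNReal.toReal_ofReal hp1', smul_eq_mul]
  have hm : ∀ k, ∫ y, f y ∂m k =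
      ((p : ℝ) ^ (k + 1))⁻¹ * ∫ y, f (y ^ p ^ (k + 1)) ∂haarProb 𝒪[F] := by
    intro k
    rw [integral_smul_measure, integral_map measurable_subtype_coe.aemeasurable
      f.continuous.aestronglyMeasurable, smul_eq_mul, ENNReal.toReal_inv, ENNReal.toReal_pow,
      ENNReal.toReal_natCast]
    congr 1
    exact integral_haarSupp p hπ (k + 1) (f.comp ⟨Subtype.val, continuous_subtype_val⟩)
  have hs := hasSum_integral_measure (hint (Measure.sum m))
  simp only [hm] at hs
  have hs' := (hs.zero_add (f := fun k : ℕ => ((p : ℝ) ^ k)⁻¹ *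
    ∫ y, f (y ^ p ^ k) ∂haarProb 𝒪[F])).mul_left (1 - 1 / (p : ℝ))
  simp only [pow_zero, pow_one, inv_one, one_mul] at hs'
  rw [hI]
  refine hs'.congr_fun fun k => ?_
  ring

/-- All exponents up to a set of density `p ^ (-K)` are exactly divisible by `p ^ k` for a unique
`k < K`, so that the means over these classes add up. -/
theorem isUD_weightedMeasure [CharP F p] (hπ : Irreducible π) {x : F}
    (hY : IsUDPrimeTo p fun n => intPart p π (x ^ n)) :
    IsUD (weightedMeasure p hπ) fun n => intPart p π (x ^ (n + 1)) := by
  intro f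
  have hp0 : (0 : ℝ) < p := by exact_mod_cast hp.out.pos
  have hp1 : (1 : ℝ) < p := by exact_mod_cast hp.out.one_lt
  refine HasMean.comp_succ (g := fun n => f (intPart p π (x ^ n))) ?_
  have hpow : ∀ k, Continuous fun y : 𝒪[F] => y ^ p ^ k := fun k => continuous_pow _
  refine hasMean_of_approx fun ε hε => ?_
  have h1 := (hasSum_integral_weightedMeasure p hπ f).tendsto_sum_nat
  have h2 : Tendsto (fun K : ℕ => ‖f‖ / (p : ℝ) ^ K) atTop (𝓝 0) :=
    tendsto_const_nhds.div_atTop (tendsto_pow_atTop_atTop_of_one_lt hp1)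
  obtain ⟨K, hK1, hK2⟩ := ((Metric.tendsto_nhds.1 h1 ε hε).and (h2.eventually_lt_const hε)).exists
  refine ⟨fun n => ∑ k ∈ Finset.range K, if p ^ k ∣ n ∧ ¬ p ^ (k + 1) ∣ n then
      f (intPart p π (x ^ (n / p ^ k)) ^ p ^ k) else 0,
    fun n => if n % p ^ K = 0 then ‖f‖ else 0, _, ‖f‖ / (p ^ K : ℕ),
    HasMean.sum _ fun k _ => hY.hasMean_exactly_dvd p k (f.comp ⟨_, hpow k⟩),
    (hasMean_const ‖f‖).ite_mod (pow_pos hp.out.pos K), fun n => ?_, ?_, ?_⟩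
  · simp only [← Nat.dvd_iff_mod_eq_zero]
    by_cases hn : p ^ K ∣ n
    · rw [if_pos hn, Finset.sum_eq_zero, sub_zero]
      · exact f.norm_coe_le_norm _
      · intro k hk
        rw [if_neg]
        rintro ⟨-, h⟩
        exact h ((pow_dvd_pow p (Finset.mem_range.1 hk)).trans hn)
    · have hn0 : n ≠ 0 := by
        rintro rfl
        exact hn (dvd_zero _)
      obtain ⟨k, m, hm, rfl⟩ := Nat.exists_eq_pow_mul_and_not_dvd hn0 p hp.out.ne_one
      have hpk : ∀ j, p ^ j ∣ p ^ k * m ↔ j ≤ k := by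
        intro j
        constructor
        · intro h
          by_contra! hlt
          have h3 := (pow_dvd_pow p hlt).trans h
          rw [pow_succ, Nat.mul_dvd_mul_iff_left (pow_pos hp.out.pos k)] at h3
          exact hm h3
        · exact fun h => (pow_dvd_pow p h).mul_right m
      rw [hpk] at hn
      rw [if_neg (by rwa [hpk]), Finset.sum_eq_single k]
      · rw [if_pos, ← intPart_pow_of_dvd p hπ x ((hpk k).2 le_rfl), sub_self, abs_zero]
        rw [hpk, hpk]
        omega
      · intro j _ hj
        rw [if_neg]
        rw [hpk, hpk]
        omega
      · intro h
        exact absurd (Finset.mem_range.2 (by omega)) h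
  · rw [Nat.cast_pow]
    exact hK2.le
  · rw [abs_sub_comm]
    exact hK1.le

/-- The `p`-th powers are confined to a clopen set of measure less than `1 / p`: modulo `π ^ 4`,
a `p`-th power depends only on its root modulo `π ^ 2`. -/
theorem exists_isClopen_pow_mem [CharP F p] (hπ : Irreducible π) :
    ∃ W : Set 𝒪[F], IsClopen W ∧ (∀ y : 𝒪[F], y ^ p ∈ W) ∧
      (haarProb 𝒪[F]).real W < 1 / p := by
  have := t2Space F
  have := finite_quotient_span_pow hπ 2
  have := Fintype.ofFinite (𝒪[F] ⧸ Ideal.span {π ^ 2})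
  let B : 𝒪[F] ⧸ Ideal.span {π ^ 2} → Set 𝒪[F] := fun c => {o | π ^ 4 ∣ o - c.out ^ p}
  refine ⟨⋃ c, B c, ?_, fun y => ?_, ?_⟩
  · refine isClopen_iUnion_of_finite fun c => ⟨?_, isOpen_setOf_pow_dvd_sub hπ 4 _⟩
    have h := (IsNoetherianRing.isClosed_ideal (Ideal.span {π ^ 4})).preimage
      (f := fun o : 𝒪[F] => o - c.out ^ p) (by fun_prop)
    convert! h using 1
    ext o
    exact Ideal.mem_span_singleton.symm
  · let c : 𝒪[F] ⧸ Ideal.span {π ^ 2} := Ideal.Quotient.mk _ y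
    refine Set.mem_iUnion.2 ⟨c, ?_⟩
    have h1 : π ^ 2 ∣ y - c.out := by
      rw [← Ideal.mem_span_singleton, ← Ideal.Quotient.mk_eq_mk_iff_sub_mem]
      exact (Ideal.Quotient.mk_out c).symm
    show π ^ 4 ∣ y ^ p - c.out ^ p
    rw [← sub_pow_char]
    calc π ^ 4 = (π ^ 2) ^ 2 := by ring
      _ ∣ (y - c.out) ^ 2 := pow_dvd_pow_of_dvd h1 2
      _ ∣ (y - c.out) ^ p := pow_dvd_pow _ hp.out.two_le
  · obtain ⟨hlt, h4⟩ := lt_card_quotient_span_sq p hπ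
    let q := Nat.card (𝒪[F] ⧸ Ideal.span {π ^ 2})
    have hq0 : (0 : ℝ) < q := by exact_mod_cast hp.out.pos.trans hlt
    have hm : (q : ℝ) ^ 2 * (haarProb 𝒪[F]).real {o | π ^ 4 ∣ o} = 1 := by
      have h := congrArg ENNReal.toReal (card_quotient_mul_haarProb hπ 4)
      rw [h4, ENNReal.toReal_mul, ENNReal.toReal_natCast, ENNReal.toReal_one, Nat.cast_pow] at h
      exact h
    have hle : (haarProb 𝒪[F]).real (⋃ c, B c) ≤ q * (haarProb 𝒪[F]).real {o | π ^ 4 ∣ o} := by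
      refine (measureReal_iUnion_fintype_le B).trans ?_
      have : ∀ c, (haarProb 𝒪[F]).real (B c) = (haarProb 𝒪[F]).real {o | π ^ 4 ∣ o} := fun c => by
        rw [Measure.real, Measure.real, haarProb_coset]
      simp only [this, Finset.sum_const, nsmul_eq_mul, q, Nat.card_eq_fintype_card]
      rfl
    have hlt' : (p : ℝ) < q := by exact_mod_cast hlt
    have hp0 : (0 : ℝ) < p := by exact_mod_cast hp.out.pos
    calc _ ≤ q * (haarProb 𝒪[F]).real {o | π ^ 4 ∣ o} := hle
      _ = 1 / q := by
        rw [eq_div_iff hq0.ne']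
        linear_combination hm
      _ < 1 / p := one_div_lt_one_div_of_lt hp0 hlt'

/-- The exponents divisible by `p` have density `1 / p`, and the corresponding integral parts are
`p`-th powers. -/
theorem not_isUD_haarProb [CharP F p] (hπ : Irreducible π) (x : F) :
    ¬ IsUD (haarProb 𝒪[F]) fun n => intPart p π (x ^ (n + 1)) := by
  intro h
  obtain ⟨W, hW, hpW, hlt⟩ := exists_isClopen_pow_mem p hπ (F := F)
  let f : C(𝒪[F], ℝ) := ⟨W.indicator 1, continuous_one.indicator (by simp [hW.frontier_eq])⟩
  have h1 : HasMean (fun n => f (intPart p π (x ^ (n + 1)))) ((haarProb 𝒪[F]).real W) := by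
    have := h f
    rwa [show ∫ y, f y ∂haarProb 𝒪[F] = (haarProb 𝒪[F]).real W from
      integral_indicator_one hW.isOpen.measurableSet] at this
  have h2 := ((hasMean_const 1).ite_mod hp.out.pos).comp_succ
  refine absurd (h2.le h1 fun n => ?_) hlt.not_ge
  split_ifs with hn
  · have hd : p ^ 1 ∣ n + 1 := by
      rw [pow_one]
      exact Nat.dvd_of_mod_eq_zero hn
    have hmem : intPart p π (x ^ (n + 1)) ∈ W := by
      rw [intPart_pow_of_dvd p hπ x hd, pow_one]
      exact hpW _
    show 1 ≤ W.indicator 1 _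
    rw [Set.indicator_of_mem hmem, Pi.one_apply]
  · exact Set.indicator_nonneg (fun _ _ => zero_le_one) _

end Consequences

end LocalFieldPowers

theorem mainTheorem3 {F : Type*} [Field F] [ValuativeRel F] [TopologicalSpace F]
    [IsNonarchimedeanLocalField F] [MeasurableSpace F] [BorelSpace F]
    (p : ℕ) [Fact p.Prime] [CharP F p] (π : 𝒪[F]) (hπ : Irreducible π)
    (ν : Measure F) [ν.IsAddHaarMeasure] :
    (∀ x : F, 1 < valuation F x →
      ¬ LocalFieldPowers.IsUD (LocalFieldPowers.haarProb 𝒪[F])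
        (fun n => LocalFieldPowers.intPart p π (x ^ (n + 1)))) ∧
    (∀ k : ℕ, 1 ≤ k → ∀ᵐ x ∂ν, 1 < valuation F x →
      ∃ y : ℕ → LocalFieldPowers.supp p π k,
        (∀ j, (y j : 𝒪[F]) = LocalFieldPowers.intPart p π
          (x ^ Nat.nth (fun n => p ^ k ∣ n ∧ ¬ p ^ (k + 1) ∣ n) j)) ∧
        LocalFieldPowers.IsUD (LocalFieldPowers.haarSupp p hπ k) y) ∧
    (∀ᵐ x ∂ν, 1 < valuation F x →
      LocalFieldPowers.IsUD (LocalFieldPowers.weightedMeasure p hπ)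
        (fun n => LocalFieldPowers.intPart p π (x ^ (n + 1)))) := by
  refine ⟨fun x _ => LocalFieldPowers.not_isUD_haarProb p hπ x, fun k _ => ?_, ?_⟩
  · filter_upwards [LocalFieldPowers.ae_isUDPrimeTo p hπ ν] with x hx h1
    exact LocalFieldPowers.exists_isUD_haarSupp p hπ (hx h1) k
  · filter_upwards [LocalFieldPowers.ae_isUDPrimeTo p hπ ν] with x hx h1
    exact LocalFieldPowers.isUD_weightedMeasure p hπ (hx h1)
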